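/- Let $\mathcal C$ be a modular tensor category over $\mathbb C$, i.e. a $\mathbb C$-linear abelian rigid braided monoidal category with $\mathbb C$-bilinear tensor product and finite-dimensional Hom spaces, which is semisimple (every object is a finite direct sum of simple objects), has simple unit object and finitely many simple objects $X_1,\dots,X_N$ up to isomorphism, and is equipped with a twist, i.e. a natural automorphism $\theta$ of the identity functor with $\theta_{X\otimes Y}=\beta_{Y,X}\beta_{X,Y}(\theta_X\otimes\theta_Y)$ and $\theta_{X^*}=(\theta_X)^*$ ($\beta$ being the braiding), such that the matrix $s_{ij}=\operatorname{Tr}(\beta_{X_j,X_i}\beta_{X_i,X_j})$ is invertible, where $\operatorname{Tr}$ is the quantum trace. Let $d_i=\operatorname{Tr}(\mathrm{id}_{X_i})$ be the categorical dimensions, let $\theta_i$ be the scalar by which the twist acts on $X_i$, let $D=\sum_i d_i^2$ be the global dimension (a positive real number), and let the central charge be the number $c$, defined modulo $8$, with $e^{\pi i c/4}=D^{-1/2}\sum_j\theta_j d_j^2$ (positive square root of $D$). Then, for every representative $c$ of the central charge, $c$ is rational (Vafa's theorem), and, as a refinement, $\dfrac{c\,N\,D^{5/2}}{2}$ is an algebraic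 integer. -/

import Mathlib

open CategoryTheory MonoidalCategory

universe v u

noncomputable section

namespace MTC

/-- A ribbon structure on a rigid braided monoidal category: a natural automorphism `θ` of the
identity functor (the twist) with `θ_{X ⊗ Y} = β_{Y,X} ∘ β_{X,Y} ∘ (θ_X ⊗ θ_Y)` and
`θ_{X*} = (θ_X)*`. -/
class RibbonCategory (C : Type u) [Category.{v} C] [MonoidalCategory C] [BraidedCategory C]
    [RigidCategory C] where
  /-- The twist. -/
  twist : ∀ X : C, X ≅ X
  twist_naturality : ∀ {X Y : C} (f : X ⟶ Y), f ≫ (twist Y).hom = (twist X).hom ≫ f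
  twist_tensor : ∀ X Y : C, (twist (X ⊗ Y)).hom =
    ((twist X).hom ⊗ₘ (twist Y).hom) ≫ (β_ X Y).hom ≫ (β_ Y X).hom
  twist_dual : ∀ X : C, (twist (HasRightDual.rightDual X)).hom = rightAdjointMate (twist X).hom

section Simple

variable (C : Type u) [Category.{v} C] [Abelian C]

/-- Isomorphism of simple objects, as a setoid. -/
def simpleSetoid : Setoid {X : C // Simple X} where
  r X Y := Nonempty (X.1 ≅ Y.1)
  iseqv := ⟨fun _ => ⟨Iso.refl _⟩, fun ⟨e⟩ => ⟨e.symm⟩, fun ⟨e⟩ ⟨f⟩ => ⟨e.trans f⟩⟩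

/-- The type of isomorphism classes of simple objects. -/
def SimpleClass : Type u := Quotient (simpleSetoid C)

variable {C}

/-- A simple object in a given isomorphism class. -/
def SimpleClass.rep (i : SimpleClass C) : C := (Quotient.out (s := simpleSetoid C) i).1

instance SimpleClass.simple_rep (i : SimpleClass C) : Simple i.rep :=
  (Quotient.out (s := simpleSetoid C) i).2

instance : DecidableEq (SimpleClass C) := Classical.decEq _

end Simple

attribute [local instance] Abelian.hasFiniteBiproducts in
/-- A `ℂ`-linear abelian category with a compatible monoidal structure is *finite semisimple* if
its `Hom` spaces are finite dimensional, every object is a finite direct sum of simple objects,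
the unit object is simple, and there are finitely many simple objects up to isomorphism. -/
class FiniteSemisimple (C : Type u) [Category.{v} C] [Abelian C] [Linear ℂ C]
    [MonoidalCategory C] : Prop where
  finiteDimensional_hom : ∀ X Y : C, FiniteDimensional ℂ (X ⟶ Y)
  exists_iso_biproduct : ∀ X : C, ∃ (n : ℕ) (S : Fin n → C),
    (∀ i, Simple (S i)) ∧ Nonempty (X ≅ ⨁ S)
  simple_unit : Simple (𝟙_ C)
  finite_simpleClass : Finite (SimpleClass C)

attribute [instance] FiniteSemisimple.finiteDimensional_hom FiniteSemisimple.simple_unit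
  FiniteSemisimple.finite_simpleClass

instance (C : Type u) [Category.{v} C] [Abelian C] [Linear ℂ C] [MonoidalCategory C]
    [FiniteSemisimple C] : Fintype (SimpleClass C) := Fintype.ofFinite _

section Scalar

variable {C : Type u} [Category.{v} C] [Abelian C] [Linear ℂ C]

/-- The scalar by which an endomorphism of a simple object acts (Schur's lemma). -/
def scalar {X : C} [Simple X] [FiniteDimensional ℂ (X ⟶ X)] (f : X ⟶ X) : ℂ :=
  (endomorphism_simple_eq_smul_id ℂ f).choose

theorem scalar_smul_id {X : C} [Simple X] [FiniteDimensional ℂ (X ⟶ X)] (f : X ⟶ X) :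
    scalar f • 𝟙 X = f :=
  (endomorphism_simple_eq_smul_id ℂ f).choose_spec

end Scalar

section Invariants

variable {C : Type u} [Category.{v} C] [Abelian C] [Linear ℂ C] [MonoidalCategory C]
  [BraidedCategory C] [RigidCategory C] [RibbonCategory C] [FiniteSemisimple C]

/-- The quantum trace of an endomorphism `f` of `X`: the scalar of the composite
`𝟙 ⟶ X ⊗ X* ⟶ X ⊗ X* ⟶ X* ⊗ X ⟶ 𝟙` of the coevaluation, `θ_X f ⊗ id`, the braiding and the
evaluation. -/
def qtrace {X : C} (f : X ⟶ X) : ℂ :=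
  scalar (η_ X (HasRightDual.rightDual X) ≫
    ((f ≫ (RibbonCategory.twist X).hom) ▷ HasRightDual.rightDual X) ≫
    (β_ X (HasRightDual.rightDual X)).hom ≫ ε_ X (HasRightDual.rightDual X))

/-- The categorical dimension. -/
def qdim (X : C) : ℂ := qtrace (𝟙 X)

variable (C)

/-- The `s`-matrix: quantum traces of the double braidings of simple objects. -/
def sMatrix : Matrix (SimpleClass C) (SimpleClass C) ℂ :=
  Matrix.of fun i j => qtrace ((β_ i.rep j.rep).hom ≫ (β_ j.rep i.rep).hom)

/-- The global dimension: the sum of the squares of the dimensions of the simple objects. -/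
def globalDim : ℂ := ∑ i : SimpleClass C, qdim i.rep ^ 2

/-- The Gauss sum `p⁺ = ∑ θ_i d_i ^ 2` over the simple objects. -/
def gaussSum : ℂ :=
  ∑ i : SimpleClass C, scalar (RibbonCategory.twist i.rep).hom * qdim i.rep ^ 2

/-- The number `c` represents the central charge, which is the class of numbers modulo `8` given by
`e ^ (π i c / 4) = p⁺ / √D`. In a modular category `D` is a positive real number, and the
principal power is its positive square root. -/
def IsCentralCharge (c : ℂ) : Prop :=
  Complex.exp (Real.pi * Complex.I * c / 4) = gaussSum C / globalDim C ^ (1 / 2 : ℂ)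

end Invariants

/-- A modular tensor category over `ℂ`: a semisimple ribbon category with simple unit and finitely
many simple objects whose `s`-matrix is non-degenerate. -/
class ModularTensorCategory (C : Type u) [Category.{v} C] [Abelian C] [Linear ℂ C]
    [MonoidalCategory C] [MonoidalPreadditive C] [MonoidalLinear ℂ C]
    [BraidedCategory C] [RigidCategory C] [RibbonCategory C] : Prop
    extends FiniteSemisimple C where
  isUnit_det_sMatrix : IsUnit (sMatrix C).det

end MTC

end

/-! The lantern relation compares the twist of a triple tensor product with the twists of its three
pairs. Its determinant on Hom(X_l, X_i ⊗ X_j ⊗ X_k) gives Vafa's multiplicative relations among the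
θ_m (`twistScalar_vafa`). Writing θ_m = exp(2πi t_m) makes them linear relations modulo ℤ. Weighted
by d_j d_k d_l and summed over j, k, l, they collapse to -D² d_i t_i (`weighted_vafa`), which is
therefore an algebraic integer, because dimensions are. Since √D / d_i is integral as well, so is
D^(5/2) t_i.

On the other side, s s' = D (s' being s with dualized rows) and the modular relation p s T⁻¹ s = D T
s T, with T = diag(θ), give p^(4N) = D^(2N) ∏ θ_i^12 on determinants. Hence cN/2 ≡ 12 ∑ t_i modulo
ℤ, and multiplying by D^(5/2) gives the refinement.

Rationality comes from the same computation. All the linear relations have rational coefficients, so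
they survive any ℚ-linear L : ℂ → ℂ with L 1 = 1, and L(c) N D^(5/2) / 2 is integral for every such
L. An irrational c could be sent anywhere by L, in particular so as to make this number 1/2. -/

noncomputable section

namespace MTC

/-! ### Sliding strands off evaluations -/

section Braided

variable {C : Type u} [Category.{v} C] [MonoidalCategory C] [BraidedCategory C]

open ExactPairing

/-- Naturality of the braiding with respect to `e`, together with the hexagon: a strand crossing
both legs of a cap can be pulled off it. -/
theorem braiding_whisker_comp {X Y V : C} (e : X ⊗ V ⟶ 𝟙_ C) :
    (β_ Y X).hom ▷ V ≫ (α_ X Y V).hom ≫ X ◁ (β_ Y V).hom ≫ (α_ X V Y).inv ≫ e ▷ Y ≫ (λ_ Y).hom =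
      (α_ Y X V).hom ≫ Y ◁ e ≫ (ρ_ Y).hom := by
  have h := BraidedCategory.braiding_naturality_right Y e
  rw [BraidedCategory.braiding_tensor_right_hom] at h
  rw [← braiding_leftUnitor, reassoc_of% h]
  simp

theorem double_braiding_comp_evaluation (X Y V W : C) [ExactPairing X V] [ExactPairing Y W] :
    ((β_ X Y).hom ≫ (β_ Y X).hom) ▷ (W ⊗ V) ≫ (β_ (X ⊗ Y) (W ⊗ V)).hom ≫ ε_ (X ⊗ Y) (W ⊗ V) =
      (α_ X Y (W ⊗ V)).hom ≫ X ◁ ((α_ Y W V).inv ≫ ((β_ Y W).hom ≫ ε_ Y W) ▷ V ≫ (λ_ V).hom) ≫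
        (β_ X V).hom ≫ ε_ X V := by
  have hε : ε_ (X ⊗ Y) (W ⊗ V) = (α_ W V (X ⊗ Y)).hom ≫ W ◁ ((α_ V X Y).inv ≫ ε_ X V ▷ Y ≫
      (λ_ Y).hom) ≫ ε_ Y W := by
    rw [ExactPairing.tensor_evaluation]; monoidal
  have hβ := BraidedCategory.braiding_naturality_left (β_ Y X).hom W
  have hA := braiding_whisker_comp (Y := Y) ((β_ X V).hom ≫ ε_ X V)
  have hB := braiding_whisker_comp (Y := X) ((β_ Y W).hom ≫ ε_ Y W)
  calc
    _ = (β_ X Y).hom ▷ (W ⊗ V) ≫ (α_ _ W V).inv ≫ ((β_ Y X).hom ▷ W ≫ (β_ (X ⊗ Y) W).hom) ▷ V ≫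
        (α_ W _ V).hom ≫ W ◁ ((β_ (X ⊗ Y) V).hom ≫ (α_ V X Y).inv ≫ ε_ X V ▷ Y ≫
      (λ_ Y).hom) ≫ ε_ Y W := by
      rw [BraidedCategory.braiding_tensor_right_hom (X ⊗ Y) W V, hε]
      monoidal
    _ = (β_ X Y).hom ▷ (W ⊗ V) ≫ (α_ _ W V).inv ≫ (β_ (Y ⊗ X) W).hom ▷ V ≫
        (α_ W _ V).hom ≫ W ◁ ((β_ Y X).hom ▷ V ≫ (α_ X Y V).hom ≫ X ◁ (β_ Y V).hom ≫
          (α_ X V Y).inv ≫ ((β_ X V).hom ≫ ε_ X V) ▷ Y ≫ (λ_ Y).hom) ≫ ε_ Y W := by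
      rw [hβ, BraidedCategory.braiding_tensor_left_hom X Y V]
      monoidal
    _ = (β_ X Y).hom ▷ (W ⊗ V) ⊗≫ (Y ◁ (β_ X W).hom) ▷ V ⊗≫
        (β_ Y W).hom ▷ (X ⊗ V) ⊗≫ ((W ⊗ Y) ◁ ((β_ X V).hom ≫ ε_ X V) ≫ ε_ Y W ▷ 𝟙_ C) ⊗≫ 𝟙 _ := by
      rw [hA, BraidedCategory.braiding_tensor_left_hom Y X W]
      monoidal
    _ = 𝟙 _ ⊗≫ ((β_ X Y).hom ▷ W ≫ (α_ Y X W).hom ≫ Y ◁ (β_ X W).hom ≫ (α_ Y W X).inv ≫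
          ((β_ Y W).hom ≫ ε_ Y W) ▷ X ≫ (λ_ X).hom) ▷ V ⊗≫ (β_ X V).hom ≫ ε_ X V := by
      rw [whisker_exchange]
      monoidal
    _ = _ := by
      rw [hB]
      monoidal

end Braided

/-! ### Traces, partial traces and the lantern relation -/

section Trace

variable {C : Type u} [Category.{v} C] [MonoidalCategory C] [BraidedCategory C]
  [RigidCategory C] [RibbonCategory C]

open RibbonCategory ExactPairing

/-- The evaluation `X ⊗ V ⟶ 𝟙` obtained from an evaluation `V ⊗ X ⟶ 𝟙` and the ribbon structure. -/
def ribbonEval (X V : C) [ExactPairing X V] : X ⊗ V ⟶ 𝟙_ C :=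
  (twist X).hom ▷ V ≫ (β_ X V).hom ≫ ε_ X V

/-- The trace of an endomorphism, computed with a given dual, as an endomorphism of the unit. -/
def pairTrace (X V : C) [ExactPairing X V] (f : X ⟶ X) : 𝟙_ C ⟶ 𝟙_ C :=
  η_ X V ≫ f ▷ V ≫ ribbonEval X V

/-- The trace does not depend on the choice of the dual, and is cyclic. -/
theorem pairTrace_comp_comm {X Y : C} (V W : C) [hV : ExactPairing X V] [hW : ExactPairing Y W]
    (f : X ⟶ Y) (g : Y ⟶ X) : pairTrace X V (f ≫ g) = pairTrace Y W (g ≫ f) := by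
  -- The mate of `f` carries `f` around the loop; naturality of the twist and the braiding does the
  -- rest.
  obtain ⟨f', h1, h2⟩ : ∃ f' : W ⟶ V, η_ X V ≫ f ▷ V = η_ Y W ≫ Y ◁ f' ∧
      f' ▷ X ≫ ε_ X V = W ◁ f ≫ ε_ Y W := by
    let : HasRightDual X := ⟨V⟩
    let : HasRightDual Y := ⟨W⟩
    exact ⟨rightAdjointMate f, (coevaluation_comp_rightAdjointMate f).symm,
      rightAdjointMate_comp_evaluation f⟩
  simp only [pairTrace, ribbonEval, comp_whiskerRight, Category.assoc]
  rw [reassoc_of% h1, whisker_exchange_assoc, whisker_exchange_assoc,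
    BraidedCategory.braiding_naturality_right_assoc, h2,
    ← BraidedCategory.braiding_naturality_left_assoc]
  simp only [← comp_whiskerRight_assoc, twist_naturality]

theorem pairTrace_eq {X : C} (V W : C) [ExactPairing X V] [ExactPairing X W]
    (f : X ⟶ X) : pairTrace X V f = pairTrace X W f := by
  simpa using pairTrace_comp_comm V W f (𝟙 X)

/-- Partial trace over the second factor. -/
def partialTrace {W : C} (Z V : C) [ExactPairing Z V] (f : W ⊗ Z ⟶ W ⊗ Z) : W ⟶ W :=
  (ρ_ W).inv ≫ W ◁ η_ Z V ≫ (α_ W Z V).inv ≫ f ▷ V ≫ (α_ W Z V).hom ≫ W ◁ ribbonEval Z V ≫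
    (ρ_ W).hom

theorem partialTrace_whiskerRight_comp {W W' : C} (Z V : C) [ExactPairing Z V] (h : W ⟶ W')
    (f : W' ⊗ Z ⟶ W' ⊗ Z) (h' : W' ⟶ W) :
    partialTrace Z V (h ▷ Z ≫ f ≫ h' ▷ Z) = h ≫ partialTrace Z V f ≫ h' := by
  have e1 : (ρ_ W).inv ≫ W ◁ η_ Z V ≫ (α_ W Z V).inv ≫ (h ▷ Z) ▷ V =
      h ≫ (ρ_ W').inv ≫ W' ◁ η_ Z V ≫ (α_ W' Z V).inv := by
    rw [rightUnitor_inv_naturality_assoc, ← whisker_exchange_assoc]; simp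
  have e2 : (h' ▷ Z) ▷ V ≫ (α_ W Z V).hom ≫ W ◁ ribbonEval Z V ≫ (ρ_ W).hom =
      (α_ W' Z V).hom ≫ W' ◁ ribbonEval Z V ≫ (ρ_ W').hom ≫ h' := by
    rw [← rightUnitor_naturality, whisker_exchange_assoc]; simp
  simp only [partialTrace, comp_whiskerRight, Category.assoc]
  rw [reassoc_of% e1, e2]

theorem partialTrace_whiskerLeft {W : C} (Y Z V : C) [ExactPairing Z V] (f : W ⊗ Z ⟶ W ⊗ Z) :
    partialTrace Z V ((α_ Y W Z).hom ≫ Y ◁ f ≫ (α_ Y W Z).inv) = Y ◁ partialTrace Z V f := by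
  simp only [partialTrace]
  monoidal

/-- The double braiding inside the twist of X ⊗ Y is exactly what unlinks the two caps, so they
become nested. Traces on a tensor product can then be taken one factor at a time. -/
theorem ribbonEval_tensor (X Y V W : C) [ExactPairing X V] [ExactPairing Y W] :
    ribbonEval (X ⊗ Y) (W ⊗ V) =
      (α_ X Y (W ⊗ V)).hom ≫ X ◁ ((α_ Y W V).inv ≫ ribbonEval Y W ▷ V ≫ (λ_ V).hom) ≫
        ribbonEval X V := by
  rw [ribbonEval, twist_tensor, comp_whiskerRight, Category.assoc,
    double_braiding_comp_evaluation X Y V W, MonoidalCategory.tensorHom_def]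
  calc
    _ = 𝟙 _ ⊗≫ (X ◁ ribbonEval Y W) ▷ V ⊗≫ (twist X).hom ▷ V ⊗≫ (β_ X V).hom ≫ ε_ X V := by
      have h := whisker_exchange (twist X).hom (ribbonEval Y W)
      simp only [ribbonEval] at h ⊢
      calc
        _ = 𝟙 _ ⊗≫ ((twist X).hom ▷ (Y ⊗ W) ≫ X ◁ ((twist Y).hom ▷ W ≫ (β_ Y W).hom ≫ ε_ Y W)) ▷ V
            ⊗≫ (β_ X V).hom ≫ ε_ X V := by monoidal
        _ = _ := by
          rw [← h]
          monoidal
    _ = _ := by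
      simp only [ribbonEval]
      monoidal

theorem pairTrace_tensor (X Y V W : C) [ExactPairing X V] [ExactPairing Y W]
    (f : X ⊗ Y ⟶ X ⊗ Y) :
    pairTrace (X ⊗ Y) (W ⊗ V) f = pairTrace X V (partialTrace Y W f) := by
  have h : η_ (X ⊗ Y) (W ⊗ V) = η_ X V ≫ ((ρ_ X).inv ≫ X ◁ η_ Y W) ▷ V ≫
      ((α_ X Y W).inv ▷ V) ≫ (α_ (X ⊗ Y) W V).hom := by
    rw [ExactPairing.tensor_coevaluation]
    monoidal
  simp only [pairTrace, partialTrace, ribbonEval_tensor, h]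
  monoidal

theorem pairTrace_swap (X : C) :
    letI := BraidedCategory.exactPairing_swap X (HasRightDual.rightDual X)
    pairTrace (HasRightDual.rightDual X) X (𝟙 _) =
      pairTrace X (HasRightDual.rightDual X) (𝟙 X) := by
  have h := coevaluation_comp_rightAdjointMate (twist X).hom
  let := BraidedCategory.exactPairing_swap X (HasRightDual.rightDual X)
  have h1 : η_ (HasRightDual.rightDual X) X = η_ X (HasRightDual.rightDual X) ≫
    (β_ (HasRightDual.rightDual X) X).inv := rfl
  have h2 : ε_ (HasRightDual.rightDual X) X = (β_ X (HasRightDual.rightDual X)).hom ≫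
    ε_ X (HasRightDual.rightDual X) := rfl
  simp only [pairTrace, ribbonEval, twist_dual, h1, h2, id_whiskerRight, Category.id_comp,
    Category.assoc]
  rw [BraidedCategory.braiding_naturality_left_assoc, Iso.inv_hom_id_assoc, reassoc_of% h]

/-- In `X ⊗ (Y ⊗ Z)`, the double braiding of `X` with `Y ⊗ Z` in terms of those with `Y` and `Z`. -/
theorem partialTrace_double_braiding (X Y Z V : C) [ExactPairing Z V] :
    partialTrace Z V ((α_ X Y Z).hom ≫ ((β_ X (Y ⊗ Z)).hom ≫ (β_ (Y ⊗ Z) X).hom) ≫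
      (α_ X Y Z).inv) =
    (β_ X Y).hom ≫ Y ◁ partialTrace Z V ((β_ X Z).hom ≫ (β_ Z X).hom) ≫ (β_ Y X).hom := by
  -- By the hexagons the outer braidings do not involve Z, so they pass out of the partial trace.
  rw [← partialTrace_whiskerLeft, ← partialTrace_whiskerRight_comp]
  congr 1
  simp [BraidedCategory.braiding_tensor_right_hom, BraidedCategory.braiding_tensor_left_hom]

/-- The twists on the tensor product of three objects: the lantern relation. -/
theorem twist_tensor_tensor (X Y Z : C) :
    (twist ((X ⊗ Y) ⊗ Z)).hom ≫ ((twist X).hom ▷ Y) ▷ Z ≫ (X ◁ (twist Y).hom) ▷ Z ≫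
        (X ⊗ Y) ◁ (twist Z).hom =
      (twist (X ⊗ Y)).hom ▷ Z ≫
        ((α_ X Y Z).hom ≫ X ◁ (β_ Y Z).hom ≫ (α_ X Z Y).inv) ≫ (twist (X ⊗ Z)).hom ▷ Y ≫
        ((α_ X Z Y).hom ≫ X ◁ (β_ Y Z).inv ≫ (α_ X Y Z).inv) ≫
        (α_ X Y Z).hom ≫ X ◁ (twist (Y ⊗ Z)).hom ≫ (α_ X Y Z).inv := by
  have h1 : (twist ((X ⊗ Y) ⊗ Z)).hom = (twist (X ⊗ Y)).hom ▷ Z ≫ (α_ X Y Z).hom ≫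
      X ◁ (Y ◁ (twist Z).hom ≫ (β_ Y Z).hom) ≫ (α_ X Z Y).inv ≫
      ((β_ X Z).hom ≫ (β_ Z X).hom) ▷ Y ≫ (α_ X Z Y).hom ≫ X ◁ (β_ Z Y).hom ≫ (α_ X Y Z).inv := by
    rw [twist_tensor (X ⊗ Y) Z, MonoidalCategory.tensorHom_def,
      BraidedCategory.braiding_tensor_left_hom, BraidedCategory.braiding_tensor_right_hom]
    monoidal
  have h2 : X ◁ (β_ Z Y).hom ≫ (twist X).hom ▷ (Y ⊗ Z) ≫ X ◁ ((twist Y).hom ▷ Z) ≫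
      X ◁ (Y ◁ (twist Z).hom) = (twist X).hom ▷ (Z ⊗ Y) ≫ X ◁ ((twist Z).hom ▷ Y ≫
        Z ◁ (twist Y).hom ≫ (β_ Z Y).hom) := by
    rw [whisker_exchange_assoc]
    simp only [← whiskerLeft_comp]
    rw [← BraidedCategory.braiding_naturality_right_assoc,
      ← BraidedCategory.braiding_naturality_left, whisker_exchange_assoc]
  have h3 : ((β_ X Z).hom ≫ (β_ Z X).hom) ≫ (twist X).hom ▷ Z =
      (twist X).hom ▷ Z ≫ (β_ X Z).hom ≫ (β_ Z X).hom := by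
    simp
  have h4 : (β_ Y Z).inv ≫ (twist (Y ⊗ Z)).hom = (twist Z).hom ▷ Y ≫ Z ◁ (twist Y).hom ≫
      (β_ Z Y).hom := by
    rw [twist_tensor, MonoidalCategory.tensorHom_def']
    simp
  -- Each object is twisted once in the triple twist but twice among the three pair twists; the
  -- single twists on the left make up the difference.
  calc
    _ = (twist (X ⊗ Y)).hom ▷ Z ≫ (α_ X Y Z).hom ≫
      X ◁ (Y ◁ (twist Z).hom ≫ (β_ Y Z).hom) ≫ (α_ X Z Y).inv ≫
      ((β_ X Z).hom ≫ (β_ Z X).hom) ▷ Y ≫ (α_ X Z Y).hom ≫ (X ◁ (β_ Z Y).hom ≫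
        (twist X).hom ▷ (Y ⊗ Z) ≫ X ◁ ((twist Y).hom ▷ Z) ≫ X ◁ (Y ◁ (twist Z).hom)) ≫
        (α_ X Y Z).inv := by
      rw [h1]; monoidal
    _ = (twist (X ⊗ Y)).hom ▷ Z ≫ (α_ X Y Z).hom ≫
      X ◁ (Y ◁ (twist Z).hom ≫ (β_ Y Z).hom) ≫ (α_ X Z Y).inv ≫
      (((β_ X Z).hom ≫ (β_ Z X).hom) ≫ (twist X).hom ▷ Z) ▷ Y ≫ (α_ X Z Y).hom ≫
        X ◁ ((β_ Y Z).inv ≫ (twist (Y ⊗ Z)).hom) ≫ (α_ X Y Z).inv := by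
      rw [h2, h4]; monoidal
    _ = _ := by
      rw [h3, twist_tensor X Z, MonoidalCategory.tensorHom_def',
        BraidedCategory.braiding_naturality_right]
      monoidal

end Trace

/-! ### Determinants of blockwise scalar operators -/

section LinearAlgebra

/-- The determinant of an operator on a product acting by scalars on the factors. -/
theorem det_of_pi_equiv {α : Type*} [Fintype α] [DecidableEq α] {V : Type*} [AddCommGroup V]
    [Module ℂ V] {W : α → Type*} [∀ a, AddCommGroup (W a)] [∀ a, Module ℂ (W a)]
    [∀ a, FiniteDimensional ℂ (W a)] (e : V ≃ₗ[ℂ] ∀ a, W a) (f : V →ₗ[ℂ] V) (t : α → ℂ)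
    (h : ∀ v a, e (f v) a = t a • e v a) :
    LinearMap.det f = ∏ a, t a ^ Module.finrank ℂ (W a) := by
  classical
  let b := (Pi.basis fun a => Module.finBasis ℂ (W a)).map e.symm
  have hm : LinearMap.toMatrix b b f = Matrix.diagonal fun x => t x.1 := by
    ext x y
    have hy : f (b y) = t y.1 • b y := by
      apply e.injective
      ext a
      rw [h, map_smul, Pi.smul_apply]
      by_cases hay : a = y.1
      · rw [hay]
      · simp [b, Pi.basis_apply, Pi.single_eq_of_ne hay]
    rw [LinearMap.toMatrix_apply, hy, map_smul, Module.Basis.repr_self]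
    by_cases hxy : x = y
    · simp [hxy]
    · simp [Matrix.diagonal_apply_ne _ hxy, Finsupp.single_eq_of_ne hxy]
  rw [← LinearMap.det_toMatrix b, hm, Matrix.det_diagonal, Fintype.prod_sigma]
  simp

end LinearAlgebra

/-! ### Decompositions into simples and multiplicities -/

section Semisimple

variable {C : Type u} [Category.{v} C] [Abelian C]

theorem SimpleClass.nonempty_rep_iso {i j : SimpleClass C} : Nonempty (i.rep ≅ j.rep) ↔ i = j := by
  constructor
  · intro h
    rw [← Quotient.out_eq (s := simpleSetoid C) i, ← Quotient.out_eq (s := simpleSetoid C) j]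
    exact Quotient.sound (s := simpleSetoid C) h
  · rintro rfl
    exact ⟨Iso.refl _⟩

/-- The class of a simple object. -/
def SimpleClass.mk (X : C) [h : Simple X] : SimpleClass C := Quotient.mk (simpleSetoid C) ⟨X, h⟩

theorem SimpleClass.nonempty_iso_rep_mk (X : C) [h : Simple X] :
    Nonempty (X ≅ (SimpleClass.mk X).rep) := by
  have := Quotient.mk_out (s := simpleSetoid C) ⟨X, h⟩
  exact ⟨this.some.symm⟩

/-- A decomposition of an object into chosen simple objects. -/
structure Decomposition (X : C) where
  /-- The number of summands. -/
  n : ℕ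
  /-- The classes of the summands. -/
  cls : Fin n → SimpleClass C
  /-- The inclusions. -/
  ι : ∀ a, (cls a).rep ⟶ X
  /-- The projections. -/
  π : ∀ a, X ⟶ (cls a).rep
  ι_π : ∀ a, ι a ≫ π a = 𝟙 _
  ι_π_ne : ∀ a b, a ≠ b → ι a ≫ π b = 0
  sum_π_ι : ∑ a, π a ≫ ι a = 𝟙 X

variable [Linear ℂ C]

theorem scalar_eq_of_eq_smul {X : C} [Simple X] [FiniteDimensional ℂ (X ⟶ X)] {f : X ⟶ X} {t : ℂ}
    (h : f = t • 𝟙 X) : scalar f = t := by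
  have h2 := scalar_smul_id f
  rw [h] at h2
  have h3 : (scalar (t • 𝟙 X) - t) • 𝟙 X = 0 := by rw [sub_smul, h2, sub_self]
  rw [h]
  exact sub_eq_zero.mp ((smul_eq_zero.mp h3).resolve_right (id_nonzero X))

/-- The multiplicity of a simple object in an object. -/
def mult (m : SimpleClass C) (X : C) : ℕ := Module.finrank ℂ (m.rep ⟶ X)

theorem mult_congr (m : SimpleClass C) {X Y : C} (e : X ≅ Y) : mult m X = mult m Y :=
  LinearEquiv.finrank_eq (Linear.homCongr ℂ (Iso.refl _) e)

variable [MonoidalCategory C] [FiniteSemisimple C]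

attribute [local instance] Abelian.hasFiniteBiproducts in
theorem nonempty_decomposition (X : C) : Nonempty (Decomposition X) := by
  obtain ⟨n, S, hS, ⟨e⟩⟩ := FiniteSemisimple.exists_iso_biproduct X
  have := hS
  let φ : ∀ a, S a ≅ (SimpleClass.mk (S a)).rep := fun a =>
    (SimpleClass.nonempty_iso_rep_mk (S a)).some
  refine ⟨⟨n, fun a => SimpleClass.mk (S a),
    fun a => (φ a).inv ≫ Limits.biproduct.ι S a ≫ e.inv,
    fun a => e.hom ≫ Limits.biproduct.π S a ≫ (φ a).hom, fun a => ?_, fun a b hab => ?_, ?_⟩⟩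
  · simp
  · simp [Limits.biproduct.ι_π_ne_assoc S hab]
  · have : ∑ a, (e.hom ≫ Limits.biproduct.π S a ≫ (φ a).hom) ≫ (φ a).inv ≫
        Limits.biproduct.ι S a ≫ e.inv = e.hom ≫ (∑ a, Limits.biproduct.π S a ≫
        Limits.biproduct.ι S a) ≫ e.inv := by
      rw [Preadditive.sum_comp, Preadditive.comp_sum]
      exact Finset.sum_congr rfl fun a _ => by simp
    rw [this, Limits.biproduct.total]
    simp

/-- A choice of decomposition of `X`. -/
def decomposition (X : C) : Decomposition X := (nonempty_decomposition X).some

theorem finrank_rep_hom_rep (m k : SimpleClass C) :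
    Module.finrank ℂ (m.rep ⟶ k.rep) = if m = k then 1 else 0 := by
  split_ifs with h
  · exact (finrank_hom_simple_simple_eq_one_iff ℂ _ _).2 (SimpleClass.nonempty_rep_iso.2 h)
  · refine finrank_hom_simple_simple_eq_zero_of_not_iso ℂ fun e => h ?_
    exact SimpleClass.nonempty_rep_iso.1 ⟨e⟩

variable {X : C} (D : Decomposition X)

/-- Maps into (the image under an additive functor of) a decomposed object. -/
def Decomposition.homEquiv (F : C ⥤ C) [F.Additive] (Y : C) :
    (Y ⟶ F.obj X) ≃ₗ[ℂ] ∀ a, (Y ⟶ F.obj (D.cls a).rep) where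
  toFun f a := f ≫ F.map (D.π a)
  map_add' f g := by ext; simp
  map_smul' c f := by ext; simp
  invFun g := ∑ a, g a ≫ F.map (D.ι a)
  left_inv f := by
    simp only [Category.assoc, ← F.map_comp, ← Preadditive.comp_sum, ← F.map_sum, D.sum_π_ι]
    simp
  right_inv g := by
    ext b
    simp only [Preadditive.sum_comp, Category.assoc, ← F.map_comp]
    rw [Finset.sum_eq_single b]
    · simp [D.ι_π]
    · intro a _ hab
      simp [D.ι_π_ne a b hab]
    · simp

/-- Maps out of a decomposed object. -/
def Decomposition.homEquiv' (Y : C) : (X ⟶ Y) ≃ₗ[ℂ] ∀ a, ((D.cls a).rep ⟶ Y) where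
  toFun f a := D.ι a ≫ f
  map_add' f g := by ext; simp
  map_smul' c f := by ext; simp
  invFun g := ∑ a, D.π a ≫ g a
  left_inv f := by
    simp only [← Category.assoc, ← Preadditive.sum_comp, D.sum_π_ι]
    simp
  right_inv g := by
    ext b
    simp only [Preadditive.comp_sum, ← Category.assoc]
    rw [Finset.sum_eq_single b]
    · simp [D.ι_π]
    · intro a _ hab
      simp [D.ι_π_ne b a hab.symm]
    · simp

theorem Decomposition.card_cls (m : SimpleClass C) :
    (Finset.univ.filter fun a => D.cls a = m).card = mult m X := by
  have h := (D.homEquiv (𝟭 C) m.rep).finrank_eq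
  rw [Module.finrank_pi_fintype] at h
  simp only [Functor.id_obj, finrank_rep_hom_rep] at h
  rw [mult, h, Finset.card_filter]
  simp only [eq_comm]

theorem Decomposition.sum_cls {M : Type*} [AddCommMonoid M] (f : SimpleClass C → M) :
    ∑ a, f (D.cls a) = ∑ m, mult m X • f m := by
  rw [← Finset.sum_fiberwise_of_maps_to (t := Finset.univ) (g := D.cls) (by simp)]
  refine Finset.sum_congr rfl fun m _ => ?_
  rw [← D.card_cls, Finset.sum_congr rfl (g := fun _ => f m), Finset.sum_const]
  intro a ha
  rw [(Finset.mem_filter.1 ha).2]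

theorem Decomposition.prod_cls {M : Type*} [CommMonoid M] (f : SimpleClass C → M) :
    ∏ a, f (D.cls a) = ∏ m, f m ^ mult m X :=
  D.sum_cls (M := Additive M) f

theorem finrank_hom_functor (F : C ⥤ C) [F.Additive] (Y X : C) :
    Module.finrank ℂ (Y ⟶ F.obj X) =
      ∑ m, mult m X * Module.finrank ℂ (Y ⟶ F.obj (SimpleClass.rep m)) := by
  have h := ((decomposition X).homEquiv F Y).finrank_eq
  rw [Module.finrank_pi_fintype] at h
  rw [h, (decomposition X).sum_cls fun m => Module.finrank ℂ (Y ⟶ F.obj m.rep)]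
  rfl

theorem finrank_hom (X Y : C) :
    Module.finrank ℂ (X ⟶ Y) = ∑ m : SimpleClass C, mult m X * mult m Y := by
  have h := ((decomposition X).homEquiv' Y).finrank_eq
  rw [Module.finrank_pi_fintype] at h
  rw [h]
  exact (decomposition X).sum_cls fun m => mult m Y

theorem mult_rep (m k : SimpleClass C) : mult m k.rep = if m = k then 1 else 0 :=
  finrank_rep_hom_rep m k

theorem finrank_hom_rep (X : C) (m : SimpleClass C) : Module.finrank ℂ (X ⟶ m.rep) = mult m X := by
  simp [finrank_hom, mult_rep]

/-- The dimension of End X is the sum of the squared multiplicities, so only one summand can occur.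
This is how duals of simples are seen to be simple. -/
theorem exists_iso_rep_of_finrank_eq_one (X : C) (h : Module.finrank ℂ (X ⟶ X) = 1) :
    ∃ m : SimpleClass C, Nonempty (X ≅ m.rep) := by
  let D := decomposition X
  rw [finrank_hom] at h
  have h1 : D.n = ∑ m, mult m X := by
    simpa only [Finset.sum_const, Finset.card_univ, Fintype.card_fin, smul_eq_mul, mul_one]
      using D.sum_cls (M := ℕ) fun _ => 1
  have h2 : ∑ m : SimpleClass C, mult m X ≤ 1 := by
    rw [← h]
    exact Finset.sum_le_sum fun m _ => Nat.le_mul_self _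
  have h3 : ∑ m : SimpleClass C, mult m X ≠ 0 := by
    intro h0
    rw [Finset.sum_eq_zero_iff] at h0
    rw [Finset.sum_eq_zero fun m hm => by rw [h0 m hm, mul_zero]] at h
    exact zero_ne_one h
  have h4 : Fintype.card (Fin D.n) = 1 := by
    rw [Fintype.card_fin]; omega
  obtain ⟨a, ha⟩ := Fintype.card_eq_one_iff.1 h4
  have hs := D.sum_π_ι
  rw [Fintype.sum_eq_single a fun b hb => absurd (ha b) hb] at hs
  exact ⟨D.cls a, ⟨⟨D.π a, D.ι a, hs, D.ι_π a⟩⟩⟩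

end Semisimple

/-! ### Additivity and multiplicativity of the quantum trace -/

section QuantumTrace

open RibbonCategory ExactPairing

variable {C : Type u} [Category.{v} C] [Abelian C] [Linear ℂ C] [MonoidalCategory C]
  [BraidedCategory C] [RigidCategory C] [RibbonCategory C] [FiniteSemisimple C]

theorem qtrace_smul_id {X : C} (V : C) [ExactPairing X V] (f : X ⟶ X) :
    qtrace f • 𝟙 (𝟙_ C) = pairTrace X V f := by
  rw [pairTrace_eq V (HasRightDual.rightDual X), qtrace, scalar_smul_id]
  simp [pairTrace, ribbonEval]

theorem qtrace_eq_of_pairTrace {X : C} (V : C) [ExactPairing X V] {f : X ⟶ X} {t : ℂ}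
    (h : pairTrace X V f = t • 𝟙 (𝟙_ C)) : qtrace f = t := by
  rw [← qtrace_smul_id] at h
  rw [← sub_eq_zero, ← sub_smul] at h
  exact sub_eq_zero.1 ((smul_eq_zero.1 h).resolve_right (id_nonzero _))

theorem qtrace_comp_comm {X Y : C} (f : X ⟶ Y) (g : Y ⟶ X) : qtrace (f ≫ g) = qtrace (g ≫ f) := by
  apply qtrace_eq_of_pairTrace (HasRightDual.rightDual X)
  rw [pairTrace_comp_comm _ (HasRightDual.rightDual Y), qtrace_smul_id (HasRightDual.rightDual Y)]

theorem qtrace_conj {X Y : C} (e : X ≅ Y) (f : X ⟶ X) : qtrace (e.inv ≫ f ≫ e.hom) = qtrace f := by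
  rw [qtrace_comp_comm]; simp

theorem qdim_congr {X Y : C} (e : X ≅ Y) : qdim X = qdim Y := by
  rw [qdim, qdim, ← qtrace_conj e]; simp

theorem qdim_rightDual (X : C) : qdim (HasRightDual.rightDual X) = qdim X := by
  let := BraidedCategory.exactPairing_swap X (HasRightDual.rightDual X)
  apply qtrace_eq_of_pairTrace X
  rw [pairTrace_swap, qdim, qtrace_smul_id (HasRightDual.rightDual X)]

variable [MonoidalPreadditive C] [MonoidalLinear ℂ C]

omit [MonoidalLinear ℂ C] in
theorem qtrace_sum {X : C} {α : Type*} (s : Finset α) (f : α → (X ⟶ X)) :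
    qtrace (∑ a ∈ s, f a) = ∑ a ∈ s, qtrace (f a) := by
  apply qtrace_eq_of_pairTrace (HasRightDual.rightDual X)
  simp only [Finset.sum_smul, qtrace_smul_id (HasRightDual.rightDual X), pairTrace,
    sum_whiskerRight, Preadditive.sum_comp, Preadditive.comp_sum]

theorem qtrace_smul {X : C} (t : ℂ) (f : X ⟶ X) : qtrace (t • f) = t * qtrace f := by
  apply qtrace_eq_of_pairTrace (HasRightDual.rightDual X)
  rw [mul_smul, qtrace_smul_id (HasRightDual.rightDual X)]
  simp [pairTrace, MonoidalLinear.smul_whiskerRight]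

-- Cyclicity and naturality move each summand of the trace onto a simple object. The functorial form
-- covers identities, twists and double braidings at once.
omit [MonoidalLinear ℂ C] in
theorem qtrace_natural (F : C ⥤ C) [F.Additive] (φ : F ⟶ F) (X : C) :
    qtrace (φ.app X) = ∑ m : SimpleClass C, mult m X * qtrace (φ.app m.rep) := by
  let D := decomposition X
  have h : φ.app X = ∑ a, F.map (D.π a) ≫ F.map (D.ι a) ≫ φ.app X := by
    simp only [← Category.assoc, ← Preadditive.sum_comp, ← F.map_comp, ← F.map_sum, D.sum_π_ι]
    simp
  rw [h, qtrace_sum]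
  have h2 : ∀ a, qtrace (F.map (D.π a) ≫ F.map (D.ι a) ≫ φ.app X) =
      qtrace (φ.app (D.cls a).rep) := by
    intro a
    rw [qtrace_comp_comm, Category.assoc, ← φ.naturality, ← Category.assoc, ← F.map_comp, D.ι_π]
    simp
  simp only [h2]
  rw [D.sum_cls fun m => qtrace (φ.app m.rep)]
  simp

omit [MonoidalLinear ℂ C] in
theorem qdim_eq_sum (X : C) : qdim X = ∑ m : SimpleClass C, mult m X * qdim m.rep :=
  qtrace_natural (𝟭 C) (𝟙 _) X

/-- The scalar by which the twist acts on a simple object. -/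
def twistScalar (i : SimpleClass C) : ℂ := scalar (twist i.rep).hom

omit [MonoidalPreadditive C] [MonoidalLinear ℂ C] in
theorem twist_rep (i : SimpleClass C) : (twist i.rep).hom = twistScalar i • 𝟙 _ :=
  (scalar_smul_id _).symm

theorem qtrace_twist (X : C) :
    qtrace (twist X).hom = ∑ m : SimpleClass C, mult m X * (twistScalar m * qdim m.rep) := by
  have h := qtrace_natural (𝟭 C) ⟨fun X => (twist X).hom, fun _ _ f => twist_naturality f⟩ X
  refine h.trans (Finset.sum_congr rfl fun m _ => ?_)
  simp only [Functor.id_obj, twist_rep, qtrace_smul, qdim]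

/-- The trace of the double braiding of two objects. -/
def hopfLink (X Y : C) : ℂ := qtrace ((β_ X Y).hom ≫ (β_ Y X).hom)

omit [MonoidalLinear ℂ C] in
theorem hopfLink_eq_sum (X Y : C) :
    hopfLink X Y = ∑ m : SimpleClass C, mult m Y * hopfLink X m.rep :=
  qtrace_natural (tensorLeft X) ⟨fun Y => (β_ X Y).hom ≫ (β_ Y X).hom, fun _ _ f => by simp⟩ Y

omit [MonoidalPreadditive C] [MonoidalLinear ℂ C] in
theorem hopfLink_congr_left {X X' : C} (e : X ≅ X') (Y : C) : hopfLink X Y = hopfLink X' Y := by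
  rw [hopfLink, ← qtrace_conj (whiskerRightIso e Y), hopfLink]
  simp

omit [MonoidalPreadditive C] [MonoidalLinear ℂ C] in
theorem hopfLink_unit (Y : C) : hopfLink (𝟙_ C) Y = qdim Y := by
  rw [← qdim_congr (λ_ Y), hopfLink, qdim]
  simp

theorem partialTrace_id (X Z V : C) [ExactPairing Z V] :
    partialTrace Z V (𝟙 (X ⊗ Z)) = qdim Z • 𝟙 X := by
  have h : partialTrace Z V (𝟙 (X ⊗ Z)) = (ρ_ X).inv ≫ X ◁ pairTrace Z V (𝟙 Z) ≫ (ρ_ X).hom := by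
    simp only [partialTrace, pairTrace]
    monoidal
  rw [h, ← qtrace_smul_id]
  simp [qdim, MonoidalLinear.whiskerLeft_smul]

theorem qtrace_of_partialTrace {X Z : C} (V : C) [ExactPairing Z V] {f : X ⊗ Z ⟶ X ⊗ Z} {t : ℂ}
    {g : X ⟶ X} (h : partialTrace Z V f = t • g) : qtrace f = t * qtrace g := by
  apply qtrace_eq_of_pairTrace (V ⊗ HasRightDual.rightDual X)
  rw [pairTrace_tensor, h, ← qtrace_smul_id, qtrace_smul]

theorem qdim_tensor (X Y : C) : qdim (X ⊗ Y) = qdim X * qdim Y := by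
  rw [mul_comm]
  exact qtrace_of_partialTrace (HasRightDual.rightDual Y) (partialTrace_id X Y _)

/-- By Schur's lemma, closing the Z-strand linked with X yields a scalar on X. The factor `qdim X`
stays on the left because dimensions are not yet known to be nonzero. -/
theorem qdim_mul_hopfLink_tensor (X Y Z : C) [Simple X] :
    qdim X * hopfLink X (Y ⊗ Z) = hopfLink X Y * hopfLink X Z := by
  have h := (scalar_smul_id (partialTrace Z (HasRightDual.rightDual Z)
    ((β_ X Z).hom ≫ (β_ Z X).hom))).symm
  set t := scalar (partialTrace Z (HasRightDual.rightDual Z) ((β_ X Z).hom ≫ (β_ Z X).hom))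
  have h1 : hopfLink X Z = t * qdim X := qtrace_of_partialTrace _ h
  have h2 : hopfLink X (Y ⊗ Z) = t * hopfLink X Y := by
    rw [hopfLink, ← qtrace_conj (α_ X Y Z).symm]
    apply qtrace_of_partialTrace (HasRightDual.rightDual Z)
    rw [Iso.symm_inv, Iso.symm_hom, partialTrace_double_braiding, h]
    simp [MonoidalLinear.whiskerLeft_smul]
  rw [h1, h2]
  ring

/-- Both sides are the trace of the twist of X_i ⊗ X_j, by the balancing axiom and by decomposition
into simples. -/
theorem hopfLink_mul_twist (i j : SimpleClass C) :
    twistScalar i * twistScalar j * hopfLink i.rep j.rep =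
      ∑ m : SimpleClass C, mult m (i.rep ⊗ j.rep) * (twistScalar m * qdim m.rep) := by
  rw [← qtrace_twist, hopfLink, ← qtrace_smul, twist_tensor, twist_rep, twist_rep]
  simp [MonoidalCategory.tensorHom_def, MonoidalLinear.whiskerLeft_smul,
    MonoidalLinear.smul_whiskerRight, mul_smul, smul_comm (twistScalar i)]

end QuantumTrace

/-! ### Duals of simples and symmetries of the fusion coefficients -/

section Duality

open RibbonCategory ExactPairing

variable {C : Type u} [Category.{v} C] [Abelian C] [Linear ℂ C] [MonoidalCategory C]
  [MonoidalPreadditive C] [MonoidalLinear ℂ C]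

/-- The linear version of `tensorLeftHomEquiv`. -/
def tensorLeftHomLinearEquiv (X Y Y' Z : C) [ExactPairing Y Y'] :
    (Y' ⊗ X ⟶ Z) ≃ₗ[ℂ] (X ⟶ Y ⊗ Z) where
  __ := tensorLeftHomEquiv X Y Y' Z
  map_add' f g := by simp [tensorLeftHomEquiv]
  map_smul' c f := by simp [tensorLeftHomEquiv, MonoidalLinear.whiskerLeft_smul]

/-- The linear version of `tensorRightHomEquiv`. -/
def tensorRightHomLinearEquiv (X Y Y' Z : C) [ExactPairing Y Y'] :
    (X ⊗ Y ⟶ Z) ≃ₗ[ℂ] (X ⟶ Z ⊗ Y') where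
  __ := tensorRightHomEquiv X Y Y' Z
  map_add' f g := by simp [tensorRightHomEquiv]
  map_smul' c f := by simp [tensorRightHomEquiv, MonoidalLinear.smul_whiskerRight]

variable [RigidCategory C]

theorem finrank_end_rightDual (X : C) :
    Module.finrank ℂ (HasRightDual.rightDual X ⟶ HasRightDual.rightDual X) =
      Module.finrank ℂ (X ⟶ X) := by
  let V := HasRightDual.rightDual X
  exact LinearEquiv.finrank_eq <|
    (Linear.homCongr ℂ (ρ_ V).symm (Iso.refl V)).trans <|
    (tensorLeftHomLinearEquiv (𝟙_ C) X V V).trans <|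
    (tensorRightHomLinearEquiv (𝟙_ C) X V X).symm.trans <|
    Linear.homCongr ℂ (λ_ X) (Iso.refl X)

theorem rightAdjointMate_smul_id (X : C) (t : ℂ) :
    rightAdjointMate (t • 𝟙 X) = t • 𝟙 (HasRightDual.rightDual X) := by
  have h := rightAdjointMate_id (X := X)
  rw [← h]
  simp only [rightAdjointMate, MonoidalLinear.whiskerLeft_smul, MonoidalLinear.smul_whiskerRight,
    Linear.smul_comp, Linear.comp_smul]

variable [FiniteSemisimple C]

theorem exists_rightDual_iso_rep (i : SimpleClass C) :
    ∃ j : SimpleClass C, Nonempty (HasRightDual.rightDual i.rep ≅ j.rep) := by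
  apply exists_iso_rep_of_finrank_eq_one
  rw [finrank_end_rightDual, finrank_endomorphism_simple_eq_one]

/-- The class of the dual. -/
def SimpleClass.dual (i : SimpleClass C) : SimpleClass C := (exists_rightDual_iso_rep i).choose

/-- The chosen representative of the dual class is the dual. -/
def SimpleClass.dualIso (i : SimpleClass C) : HasRightDual.rightDual i.rep ≅ i.dual.rep :=
  (exists_rightDual_iso_rep i).choose_spec.some

/-- The fusion coefficients. -/
def fusion (i j k : SimpleClass C) : ℕ := mult k (i.rep ⊗ j.rep)

omit [MonoidalLinear ℂ C] [RigidCategory C] in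
theorem mult_tensor_rep (X : C) (j l : SimpleClass C) :
    mult l (X ⊗ j.rep) = ∑ m, mult m X * fusion m j l :=
  finrank_hom_functor (tensorRight j.rep) l.rep X

theorem fusion_dual (i j m : SimpleClass C) : fusion i j m = fusion i.dual m j := by
  have h := (tensorLeftHomLinearEquiv m.rep i.rep (HasRightDual.rightDual i.rep) j.rep).finrank_eq
  rw [finrank_hom_rep] at h
  rw [fusion, mult, ← h]
  exact mult_congr j (whiskerRightIso i.dualIso m.rep)

variable [BraidedCategory C]

omit [MonoidalPreadditive C] [MonoidalLinear ℂ C] [RigidCategory C]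
  [FiniteSemisimple C] in
theorem fusion_comm (i j k : SimpleClass C) : fusion i j k = fusion j i k :=
  mult_congr k (β_ _ _)

/-- The braiding makes X a right dual of X*, and right duals are unique. -/
theorem SimpleClass.dual_dual (i : SimpleClass C) : i.dual.dual = i := by
  have e1 : i.dual.dual.rep ≅ HasRightDual.rightDual i.dual.rep := i.dual.dualIso.symm
  let p1 : ExactPairing (HasRightDual.rightDual i.rep) i.rep :=
    BraidedCategory.exactPairing_swap i.rep (HasRightDual.rightDual i.rep)
  let p2 : ExactPairing i.dual.rep i.rep := exactPairingCongrLeft i.dualIso.symm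
  have e2 : HasRightDual.rightDual i.dual.rep ≅ i.rep := rightDualIso inferInstance p2
  exact SimpleClass.nonempty_rep_iso.1 ⟨e1 ≪≫ e2⟩

variable [RibbonCategory C]

theorem qdim_dual (i : SimpleClass C) : qdim i.dual.rep = qdim i.rep := by
  rw [← qdim_congr i.dualIso, qdim_rightDual]

theorem twistScalar_dual (i : SimpleClass C) : twistScalar i.dual = twistScalar i := by
  apply scalar_eq_of_eq_smul
  have h := twist_naturality i.dualIso.inv
  rw [twist_dual, twist_rep, rightAdjointMate_smul_id] at h
  rw [← cancel_mono i.dualIso.inv, ← h]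
  simp

end Duality

/-! ### Vafa's relations from determinants -/

section Vafa

variable {C : Type u} [Category.{v} C] [Abelian C] [Linear ℂ C]

/-- The determinant of postcomposition with an endomorphism. -/
def homDet (l : SimpleClass C) {X : C} (f : X ⟶ X) : ℂ :=
  LinearMap.det (Linear.rightComp ℂ l.rep f)

theorem homDet_comp (l : SimpleClass C) {X : C} (f g : X ⟶ X) :
    homDet l (f ≫ g) = homDet l f * homDet l g := by
  rw [mul_comm, homDet, homDet, homDet, ← map_mul]
  congr 1
  ext h
  simp

theorem homDet_conj (l : SimpleClass C) {X Y : C} (e : X ≅ Y) (f : Y ⟶ Y) :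
    homDet l (e.hom ≫ f ≫ e.inv) = homDet l f := by
  rw [homDet, homDet, ← LinearMap.det_conj _ (Linear.homCongr ℂ (Iso.refl l.rep) e.symm)]
  congr 1
  ext h
  simp [Linear.homCongr]

theorem homDet_smul_id (l : SimpleClass C) (X : C) (t : ℂ) : homDet l (t • 𝟙 X) = t ^ mult l X := by
  have h : Linear.rightComp ℂ l.rep (t • 𝟙 X) = t • LinearMap.id := by ext h; simp
  rw [homDet, h, LinearMap.det_smul, LinearMap.det_id, mul_one]
  rfl

open RibbonCategory

variable [MonoidalCategory C] [BraidedCategory C] [RigidCategory C] [RibbonCategory C]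
  [FiniteSemisimple C]

/-- By naturality, the twist of X acts on Hom(X_l, X) as the twist of X_l does. -/
theorem homDet_twist (l : SimpleClass C) (X : C) :
    homDet l (twist X).hom = twistScalar l ^ mult l X := by
  rw [← homDet_smul_id, homDet, homDet]
  congr 1
  ext h
  have := twist_naturality h
  simp [twist_rep, this]

theorem homDet_map_twist (l : SimpleClass C) (F : C ⥤ C) [F.Additive] [F.Linear ℂ] (X : C) :
    homDet l (F.map (twist X).hom) = ∏ m, twistScalar m ^ (mult m X * mult l (F.obj m.rep)) := by
  let D := decomposition X
  have h := det_of_pi_equiv (D.homEquiv F l.rep) (Linear.rightComp ℂ l.rep (F.map (twist X).hom))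
    (fun a => twistScalar (D.cls a)) (by
      intro f a
      have := twist_naturality (D.π a)
      simp only [Decomposition.homEquiv, LinearEquiv.coe_mk, LinearMap.coe_mk, AddHom.coe_mk,
        Linear.rightComp_apply, Category.assoc, ← F.map_comp, ← this, twist_rep]
      simp [F.map_smul])
  refine h.trans ((D.prod_cls fun m => twistScalar m ^ mult l (F.obj m.rep)).trans ?_)
  simp only [← pow_mul, mul_comm]

variable [MonoidalPreadditive C] [MonoidalLinear ℂ C]

/-- Determinant of the lantern relation on Hom(X_l, X_i ⊗ X_j ⊗ X_k). The associators and braidings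
only conjugate, so they drop out, and each pair twist contributes through the simple summands of its
pair. -/
theorem twistScalar_vafa (i j k l : SimpleClass C) :
    (twistScalar i * twistScalar j * twistScalar k * twistScalar l) ^
        (∑ m, fusion i j m * fusion m k l) =
      ∏ m, twistScalar m ^ (fusion i j m * fusion m k l + fusion j k m * fusion i m l +
        fusion i k m * fusion m j l) := by
  have h := congrArg (homDet l) (twist_tensor_tensor i.rep j.rep k.rep)
  have e1 : ((twist i.rep).hom ▷ j.rep) ▷ k.rep ≫ (i.rep ◁ (twist j.rep).hom) ▷ k.rep ≫
        (i.rep ⊗ j.rep) ◁ (twist k.rep).hom =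
      (twistScalar i * twistScalar j * twistScalar k) • 𝟙 ((i.rep ⊗ j.rep) ⊗ k.rep) := by
    simp [twist_rep, MonoidalLinear.whiskerLeft_smul, MonoidalLinear.smul_whiskerRight, smul_smul,
      mul_assoc, mul_comm]
  have e2 := homDet_conj l ((α_ i.rep j.rep k.rep) ≪≫ whiskerLeftIso i.rep (β_ j.rep k.rep) ≪≫
    (α_ i.rep k.rep j.rep).symm) ((twist (i.rep ⊗ k.rep)).hom ▷ j.rep)
  have e3 := homDet_conj l (α_ i.rep j.rep k.rep) (i.rep ◁ (twist (j.rep ⊗ k.rep)).hom)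
  have e4 : homDet l ((twist (i.rep ⊗ j.rep)).hom ▷ k.rep) =
      ∏ m, twistScalar m ^ (fusion i j m * fusion m k l) :=
    homDet_map_twist l (tensorRight k.rep) (i.rep ⊗ j.rep)
  have e5 : homDet l (i.rep ◁ (twist (j.rep ⊗ k.rep)).hom) =
      ∏ m, twistScalar m ^ (fusion j k m * fusion i m l) :=
    homDet_map_twist l (tensorLeft i.rep) (j.rep ⊗ k.rep)
  have e6 : homDet l ((twist (i.rep ⊗ k.rep)).hom ▷ j.rep) =
      ∏ m, twistScalar m ^ (fusion i k m * fusion m j l) :=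
    homDet_map_twist l (tensorRight j.rep) (i.rep ⊗ k.rep)
  have e7 : mult l ((i.rep ⊗ j.rep) ⊗ k.rep) = ∑ m, fusion i j m * fusion m k l :=
    mult_tensor_rep _ _ _
  simp only [Iso.trans_hom, Iso.trans_inv, whiskerLeftIso_hom, whiskerLeftIso_inv, Iso.symm_hom,
    Iso.symm_inv, Category.assoc] at e2
  rw [e1, homDet_comp, homDet_comp, homDet_twist, homDet_smul_id, e4, e7] at h
  have h2 : homDet l (((α_ i.rep j.rep k.rep).hom ≫ i.rep ◁ (β_ j.rep k.rep).hom ≫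
      (α_ i.rep k.rep j.rep).inv) ≫ (twist (i.rep ⊗ k.rep)).hom ▷ j.rep ≫
      ((α_ i.rep k.rep j.rep).hom ≫ i.rep ◁ (β_ j.rep k.rep).inv ≫ (α_ i.rep j.rep k.rep).inv) ≫
      (α_ i.rep j.rep k.rep).hom ≫ i.rep ◁ (twist (j.rep ⊗ k.rep)).hom ≫
      (α_ i.rep j.rep k.rep).inv) =
      homDet l ((twist (i.rep ⊗ k.rep)).hom ▷ j.rep) *
        homDet l (i.rep ◁ (twist (j.rep ⊗ k.rep)).hom) := by
    rw [← e2, ← e3, ← homDet_comp]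
    simp
  rw [h2, e5, e6] at h
  simp only [pow_add, Finset.prod_mul_distrib]
  rw [mul_pow, mul_comm, h]
  ring

end Vafa

/-! ### Modular data: orthogonality and integrality -/

section Numeric

/-- An eigenvalue of a matrix of natural numbers is integral. -/
theorem isIntegral_of_mul_eq_sum {I : Type*} [Fintype I] {x : ℂ} {f : I → ℂ} (n : I → I → ℕ)
    (h : ∀ k, x * f k = ∑ l, n k l * f l) {k₀ : I} (hk : f k₀ ≠ 0) : IsIntegral ℤ x := by
  refine isIntegral_of_smul_mem_submodule (Submodule.span ℤ (Set.range f)) ?_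
    (Submodule.fg_span (Set.finite_range f)) x fun y hy => ?_
  · intro hbot
    have : f k₀ ∈ Submodule.span ℤ (Set.range f) := Submodule.subset_span ⟨k₀, rfl⟩
    rw [hbot, Submodule.mem_bot] at this
    exact hk this
  · induction hy using Submodule.span_induction with
    | mem y hy =>
      obtain ⟨k, rfl⟩ := hy
      rw [smul_eq_mul, h]
      refine Submodule.sum_mem _ fun l _ => ?_
      have := Submodule.smul_mem (Submodule.span ℤ (Set.range f)) (n k l : ℤ)
        (Submodule.subset_span ⟨l, rfl⟩)
      simpa using this
    | zero => simp
    | add y z _ _ hy hz => rw [smul_add]; exact add_mem hy hz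
    | smul a y _ hy => rw [smul_comm]; exact Submodule.smul_mem _ _ hy

theorem not_isIntegral_half : ¬ IsIntegral ℤ (1 / 2 : ℂ) := by
  intro h
  have h1 : IsIntegral ℤ (algebraMap ℚ ℂ (1 / 2)) := by simpa using h
  rw [isIntegral_algebraMap_iff (algebraMap ℚ ℂ).injective] at h1
  obtain ⟨n, hn⟩ := IsIntegrallyClosed.isIntegral_iff.1 h1
  have h2 : (2 * n : ℤ) = 1 := by
    have : (2 * n : ℚ) = 1 := by
      rw [show (n : ℚ) = 1 / 2 from hn]; norm_num
    exact_mod_cast this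
  omega

/-- A `ℚ`-linear endomorphism of `ℂ` that fixes `1` can send an irrational number anywhere. -/
theorem exists_linearMap_of_irrational {c : ℂ} (hc : ¬ ∃ q : ℚ, c = q) (w : ℂ) :
    ∃ L : ℂ →ₗ[ℚ] ℂ, L 1 = 1 ∧ L c = w := by
  have h : c ∉ Submodule.span ℚ {(1 : ℂ)} := by
    rw [Submodule.mem_span_singleton]
    rintro ⟨q, hq⟩
    exact hc ⟨q, by rw [← hq, Rat.smul_def, mul_one]⟩
  obtain ⟨f, hf, hf1⟩ := Submodule.exists_le_ker_of_notMem h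
  have h1 : f 1 = 0 := hf1 (Submodule.mem_span_singleton_self _)
  -- The functional `f` kills 1 but not c, so this correction changes only the value at c as
  -- required.
  refine ⟨LinearMap.id + f.smulRight ((w - c) / f c), by simp [h1], ?_⟩
  have : (f c : ℂ) ≠ 0 := by exact_mod_cast hf
  simp only [LinearMap.add_apply, LinearMap.id_apply, LinearMap.smulRight_apply, Rat.smul_def]
  field_simp
  ring

/-- The numerical data of a modular category. -/
structure ModularData (I : Type*) [Fintype I] [DecidableEq I] where
  /-- The fusion coefficients. -/
  N : I → I → I → ℕ
  /-- The `s`-matrix. -/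
  s : Matrix I I ℂ
  /-- The dimensions. -/
  d : I → ℂ
  /-- The twists. -/
  θ : I → ℂ
  /-- The duality. -/
  dual : I → I
  /-- The class of the unit. -/
  one : I
  N_comm : ∀ i j k, N i j k = N j i k
  N_dual : ∀ i j k, N i j k = N (dual i) k j
  dual_dual : ∀ i, dual (dual i) = i
  d_dual : ∀ i, d (dual i) = d i
  θ_dual : ∀ i, θ (dual i) = θ i
  θ_ne_zero : ∀ i, θ i ≠ 0
  d_mul : ∀ i j, d i * d j = ∑ k, N i j k * d k
  θ_mul_s : ∀ i j, θ i * θ j * s i j = ∑ k, N i j k * (θ k * d k)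
  s_mul : ∀ i j k, s i j * s i k = d i * ∑ l, N j k l * s i l
  s_one : ∀ j, s one j = d j
  vafa : ∀ i j k l, (θ i * θ j * θ k * θ l) ^ (∑ m, N i j m * N m k l) =
    ∏ m, θ m ^ (N i j m * N m k l + N j k m * N i m l + N i k m * N m j l)
  isUnit_det_s : IsUnit s.det

namespace ModularData

variable {I : Type*} [Fintype I] [DecidableEq I] (M : ModularData I)

/-- Duality as a permutation. -/
def dualPerm : Equiv.Perm I := Function.Involutive.toPerm M.dual M.dual_dual

theorem sum_dual {A : Type*} [AddCommMonoid A] (f : I → A) : ∑ i, f (M.dual i) = ∑ i, f i :=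
  Equiv.sum_comp M.dualPerm f

theorem s_comm (i j : I) : M.s i j = M.s j i := by
  have h : M.θ i * M.θ j * M.s i j = M.θ i * M.θ j * M.s j i := by
    rw [M.θ_mul_s, mul_comm (M.θ i), M.θ_mul_s]
    simp only [M.N_comm i j]
  exact mul_left_cancel₀ (mul_ne_zero (M.θ_ne_zero i) (M.θ_ne_zero j)) h

theorem s_apply_one (j : I) : M.s j M.one = M.d j := by rw [s_comm, M.s_one]

theorem det_s_ne_zero : M.s.det ≠ 0 := M.isUnit_det_s.ne_zero

/-- A vanishing dimension would force a zero row of s through `s_mul`. -/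
theorem d_ne_zero (i : I) : M.d i ≠ 0 := by
  intro h
  apply M.det_s_ne_zero
  apply Matrix.det_eq_zero_of_row_eq_zero i
  intro j
  have := M.s_mul i j j
  rw [h, zero_mul] at this
  exact mul_self_eq_zero.1 this

theorem N_dual_dual (i j k : I) : M.N (M.dual i) (M.dual j) (M.dual k) = M.N i j k := by
  rw [M.N_dual i j k, M.N_comm (M.dual i) k j, M.N_dual k, M.N_comm (M.dual k) j, M.N_dual j,
    M.N_comm]

theorem s_dual (i j : I) : M.s (M.dual i) j = M.s i (M.dual j) := by
  have h : M.θ i * M.θ j * M.s (M.dual i) j = M.θ i * M.θ j * M.s i (M.dual j) := by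
    have h1 := M.θ_mul_s (M.dual i) j
    have h2 := M.θ_mul_s i (M.dual j)
    rw [M.θ_dual] at h1 h2
    rw [h1, h2, ← M.sum_dual]
    refine Finset.sum_congr rfl fun k _ => ?_
    rw [M.θ_dual, M.d_dual, ← M.N_dual_dual i, M.dual_dual]
  exact mul_left_cancel₀ (mul_ne_zero (M.θ_ne_zero i) (M.θ_ne_zero j)) h

theorem sum_N_mul_d (i m : I) : ∑ j, M.N i j m * M.d j = M.d i * M.d m := by
  simp only [M.N_dual i _ m]
  rw [← M.d_mul, M.d_dual]

theorem sum_N_mul_d' (j m : I) : ∑ i, M.N i j m * M.d i = M.d j * M.d m := by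
  simp only [M.N_comm _ j m]
  exact M.sum_N_mul_d j m

/-- The `s`-matrix composed with duality. -/
def sDual : Matrix I I ℂ := M.s.submatrix M.dualPerm id

theorem sDual_apply (i j : I) : M.sDual i j = M.s (M.dual i) j := rfl

/-- Orthogonality of the characters a ↦ s_ia / d_i of the fusion ring: a nonzero pairing would make
rows i and k of s proportional, against invertibility. -/
theorem mul_sDual_apply_of_ne {i k : I} (hik : i ≠ k) : (M.s * M.sDual) i k = 0 := by
  by_contra hne
  have key : ∀ a, M.d k * M.s i a = M.d i * M.s k a := by
    intro a
    have h1 : ∀ l, M.d k * ∑ j, M.N a j l * M.sDual j k = M.s k (M.dual l) * M.s k a := by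
      intro l
      rw [M.s_mul, ← M.sum_dual]
      congr 1
      refine Finset.sum_congr rfl fun j _ => ?_
      rw [sDual_apply, M.s_comm, M.N_dual a _ l, M.N_comm (M.dual a), ← M.N_dual_dual l]
      simp only [M.dual_dual]
    have h2 : M.d k * M.s i a * (M.s * M.sDual) i k = M.d i * M.s k a * (M.s * M.sDual) i k := by
      calc M.d k * M.s i a * (M.s * M.sDual) i k
          = M.d k * ∑ j, (M.s i a * M.s i j) * M.sDual j k := by
            rw [Matrix.mul_apply, mul_assoc, Finset.mul_sum]
            simp only [mul_assoc]
        _ = M.d i * ∑ l, M.s i l * (M.d k * ∑ j, M.N a j l * M.sDual j k) := by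
            simp only [M.s_mul, Finset.mul_sum, Finset.sum_mul]
            rw [Finset.sum_comm]
            refine Finset.sum_congr rfl fun l _ => Finset.sum_congr rfl fun j _ => ?_
            ring
        _ = _ := by
            simp only [h1]
            rw [Matrix.mul_apply, Finset.mul_sum, Finset.mul_sum]
            refine Finset.sum_congr rfl fun l _ => ?_
            rw [sDual_apply, M.s_comm (M.dual l)]
            ring
    exact mul_right_cancel₀ hne h2
  have h3 := Matrix.eq_zero_of_vecMul_eq_zero M.det_s_ne_zero
    (v := Pi.single i (M.d k) - Pi.single k (M.d i)) (by
      ext a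
      simp [Matrix.sub_vecMul, Matrix.single_vecMul, key])
  have h4 := congrFun h3 i
  simp [hik] at h4
  exact M.d_ne_zero k h4

/-- The global dimension. -/
def D : ℂ := ∑ i, M.d i ^ 2

theorem sDual_mul : M.sDual * M.s = M.s * M.sDual := by
  ext i k
  rw [Matrix.mul_apply, Matrix.mul_apply, ← M.sum_dual]
  simp only [sDual_apply, M.s_dual, M.dual_dual]

/-- The product is diagonal and commutes with s. As the unit row of s has nonzero entries d_j, all
diagonal entries agree with the one at the unit. -/
theorem mul_sDual : M.s * M.sDual = Matrix.diagonal fun _ => M.D := by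
  have hdiag : M.s * M.sDual = Matrix.diagonal fun i => (M.s * M.sDual) i i := by
    ext i k
    by_cases h : i = k
    · subst h; simp
    · rw [Matrix.diagonal_apply_ne _ h, M.mul_sDual_apply_of_ne h]
  have hone : (M.s * M.sDual) M.one M.one = M.D := by
    rw [Matrix.mul_apply, D]
    simp only [sDual_apply, M.s_one, M.s_apply_one, M.d_dual, pow_two]
  have hcomm : M.s * (M.s * M.sDual) = (M.s * M.sDual) * M.s := by
    rw [Matrix.mul_assoc, M.sDual_mul]
  rw [hdiag]
  congr 1
  funext j
  rw [hdiag] at hcomm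
  have h := congrFun (congrFun hcomm M.one) j
  rw [Matrix.mul_diagonal, Matrix.diagonal_mul, M.s_one, hone, mul_comm] at h
  exact mul_right_cancel₀ (M.d_ne_zero j) h

theorem det_s_pow_four : M.s.det ^ 4 = M.D ^ (2 * Fintype.card I) := by
  have h := congrArg Matrix.det M.mul_sDual
  rw [Matrix.det_mul, Matrix.det_diagonal, sDual, Matrix.det_permute, Finset.prod_const,
    Finset.card_univ] at h
  have hs : ((Equiv.Perm.sign M.dualPerm : ℤ) : ℂ) ^ 2 = 1 := by
    have : (Equiv.Perm.sign M.dualPerm : ℤ) ^ 2 = 1 := by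
      rw [← Units.val_pow_eq_pow_val, Int.units_sq, Units.val_one]
    exact_mod_cast this
  calc M.s.det ^ 4 = (M.s.det * (((Equiv.Perm.sign M.dualPerm : ℤ) : ℂ) * M.s.det)) ^ 2 := by
        rw [mul_pow, mul_pow, hs]; ring
    _ = _ := by rw [h, ← pow_mul, mul_comm 2]

theorem D_ne_zero : M.D ≠ 0 := by
  intro h
  have h4 := M.det_s_pow_four
  have : Nonempty I := ⟨M.one⟩
  rw [h, zero_pow (by positivity)] at h4
  exact M.det_s_ne_zero (pow_eq_zero_iff (by norm_num) |>.1 h4)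

theorem isIntegral_d (i : I) : IsIntegral ℤ (M.d i) :=
  isIntegral_of_mul_eq_sum (f := M.d) (M.N i) (fun k => M.d_mul i k) (M.d_ne_zero M.one)

theorem isIntegral_D : IsIntegral ℤ M.D :=
  IsIntegral.sum _ fun i _ => (M.isIntegral_d i).pow 2

theorem isIntegral_s_div_d (i j : I) : IsIntegral ℤ (M.s i j / M.d i) := by
  refine isIntegral_of_mul_eq_sum (f := fun k => M.s i k / M.d i) (M.N j) (fun k => ?_)
    (k₀ := M.one) (div_ne_zero (by rw [M.s_apply_one]; exact M.d_ne_zero i) (M.d_ne_zero i))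
  have := M.d_ne_zero i
  rw [div_mul_div_comm, M.s_mul, mul_div_mul_left _ _ this, Finset.sum_div]
  simp only [mul_div_assoc]

/-- The diagonal of `mul_sDual` exhibits D / d_i² as a sum of products of the integral numbers s_ij
/ d_i. -/
theorem isIntegral_div_d {r : ℂ} (hr : r ^ 2 = M.D) (i : I) : IsIntegral ℤ (r / M.d i) := by
  refine IsIntegral.of_pow (n := 2) (by norm_num) ?_
  have h : (r / M.d i) ^ 2 = ∑ j, M.s i j / M.d i * (M.s i (M.dual j) / M.d i) := by
    have h1 := congrFun (congrFun M.mul_sDual i) i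
    rw [Matrix.mul_apply, Matrix.diagonal_apply_eq] at h1
    rw [div_pow, hr, ← h1, Finset.sum_div]
    refine Finset.sum_congr rfl fun j _ => ?_
    rw [sDual_apply, M.s_comm (M.dual j), pow_two, mul_div_mul_comm]
  rw [h]
  exact IsIntegral.sum _ fun j _ => (M.isIntegral_s_div_d i j).mul (M.isIntegral_s_div_d i _)

end ModularData

end Numeric

namespace ModularData

variable {I : Type*} [Fintype I] [DecidableEq I] (M : ModularData I)

/-! ### Summing Vafa's relations against the dimensions -/

section Vafa

theorem sum_N_mul_N_left (i : I) (x y z w : I → ℂ) :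
    ∑ j, ∑ k, ∑ l, x j * y k * z l * ∑ m, (M.N i j m * M.N m k l : ℂ) * w m =
      ∑ m, w m * (∑ j, M.N i j m * x j) * ∑ k, y k * ∑ l, M.N m k l * z l := by
  simp only [Finset.mul_sum, Finset.sum_mul]
  calc _ = ∑ j, ∑ k, ∑ m, ∑ l, x j * y k * z l * ((M.N i j m * M.N m k l : ℂ) * w m) :=
        Finset.sum_congr rfl fun j _ => Finset.sum_congr rfl fun k _ => Finset.sum_comm
    _ = ∑ j, ∑ m, ∑ k, ∑ l, x j * y k * z l * ((M.N i j m * M.N m k l : ℂ) * w m) :=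
        Finset.sum_congr rfl fun j _ => Finset.sum_comm
    _ = ∑ m, ∑ j, ∑ k, ∑ l, x j * y k * z l * ((M.N i j m * M.N m k l : ℂ) * w m) :=
        Finset.sum_comm
    _ = ∑ m, ∑ k, ∑ j, ∑ l, x j * y k * z l * ((M.N i j m * M.N m k l : ℂ) * w m) :=
        Finset.sum_congr rfl fun m _ => Finset.sum_comm
    _ = ∑ m, ∑ k, ∑ l, ∑ j, x j * y k * z l * ((M.N i j m * M.N m k l : ℂ) * w m) :=
        Finset.sum_congr rfl fun m _ => Finset.sum_congr rfl fun k _ => Finset.sum_comm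
    _ = _ := by
      refine Finset.sum_congr rfl fun m _ => Finset.sum_congr rfl fun k _ =>
        Finset.sum_congr rfl fun l _ => Finset.sum_congr rfl fun j _ => ?_
      ring

theorem sum_N_mul_N_right (i : I) (x y z w : I → ℂ) :
    ∑ j, ∑ k, ∑ l, x j * y k * z l * ∑ m, (M.N j k m * M.N i m l : ℂ) * w m =
      ∑ m, w m * (∑ l, M.N i m l * z l) * ∑ j, x j * ∑ k, M.N j k m * y k := by
  simp only [Finset.mul_sum, Finset.sum_mul]
  calc _ = ∑ j, ∑ k, ∑ m, ∑ l, x j * y k * z l * ((M.N j k m * M.N i m l : ℂ) * w m) :=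
        Finset.sum_congr rfl fun j _ => Finset.sum_congr rfl fun k _ => Finset.sum_comm
    _ = ∑ j, ∑ m, ∑ k, ∑ l, x j * y k * z l * ((M.N j k m * M.N i m l : ℂ) * w m) :=
        Finset.sum_congr rfl fun j _ => Finset.sum_comm
    _ = ∑ m, ∑ j, ∑ k, ∑ l, x j * y k * z l * ((M.N j k m * M.N i m l : ℂ) * w m) :=
        Finset.sum_comm
    _ = _ := by
      refine Finset.sum_congr rfl fun m _ => Finset.sum_congr rfl fun j _ =>
        Finset.sum_congr rfl fun k _ => Finset.sum_congr rfl fun l _ => ?_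
      ring

theorem sum_mul_sum_N (m : I) (y z : I → ℂ) (h : z = M.d ∨ y = M.d) :
    ∑ k, y k * ∑ l, M.N m k l * z l = M.d m * ∑ k, y k * z k := by
  rcases h with rfl | rfl
  · simp only [← M.d_mul, Finset.mul_sum]
    exact Finset.sum_congr rfl fun k _ => by ring
  · simp only [Finset.mul_sum]
    rw [Finset.sum_comm]
    refine Finset.sum_congr rfl fun l _ => ?_
    calc _ = (∑ k, M.N m k l * M.d k) * z l := by
          rw [Finset.sum_mul]
          exact Finset.sum_congr rfl fun k _ => by ring
      _ = _ := by rw [M.sum_N_mul_d]; ring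

theorem sum_d_mul_d : ∑ i, M.d i * M.d i = M.D := by simp only [D, pow_two]

/-- An additive form of Vafa's relations. -/
def VafaRelation (u : I → ℂ) : Prop :=
  ∀ i j k l, ∃ z : ℤ,
    ∑ m, (M.N i j m * M.N m k l + M.N j k m * M.N i m l + M.N i k m * M.N m j l : ℂ) * u m -
      (∑ m, (M.N i j m * M.N m k l : ℂ)) * (u i + u j + u k + u l) = z

/-- The dimension vector is a common eigenvector of the fusion matrices. Hence the three fusion
terms and the terms in u_j, u_k, u_l each sum to d_i D E, with E = ∑ d_k² u_k; they cancel, leaving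
the term in u_i. -/
theorem weighted_vafa (u : I → ℂ) (i : I) :
    ∑ j, ∑ k, ∑ l, M.d j * M.d k * M.d l *
      (∑ m, (M.N i j m * M.N m k l + M.N j k m * M.N i m l + M.N i k m * M.N m j l : ℂ) * u m -
      (∑ m, (M.N i j m * M.N m k l : ℂ)) * (u i + u j + u k + u l)) =
    -(M.D ^ 2 * M.d i * u i) := by
  set E := ∑ k, M.d k * (M.d k * u k) with hE
  have hE' : ∑ k, M.d k * u k * M.d k = E := Finset.sum_congr rfl fun k _ => by ring
  have e1 := M.sum_N_mul_N_left i M.d M.d M.d u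
  have e2 := M.sum_N_mul_N_right i M.d M.d M.d u
  have e4 := M.sum_N_mul_N_left i M.d M.d M.d fun _ => u i
  have e5 := M.sum_N_mul_N_left i (fun j => M.d j * u j) M.d M.d fun _ => 1
  have e6 := M.sum_N_mul_N_left i M.d (fun j => M.d j * u j) M.d fun _ => 1
  have e7 := M.sum_N_mul_N_left i M.d M.d (fun j => M.d j * u j) fun _ => 1
  have e3 : ∑ j, ∑ k, ∑ l, M.d j * M.d k * M.d l * ∑ m, (M.N i k m * M.N m j l : ℂ) * u m =
      ∑ j, ∑ k, ∑ l, M.d j * M.d k * M.d l * ∑ m, (M.N i j m * M.N m k l : ℂ) * u m := by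
    rw [Finset.sum_comm]
    simp only [mul_comm (M.d _) (M.d _)]
  have hk : ∀ m, ∑ k, M.d k * ∑ l, (M.N m k l : ℂ) * M.d l = M.d m * M.D := fun m => by
    rw [M.sum_mul_sum_N m M.d M.d (Or.inl rfl), M.sum_d_mul_d]
  have hk6 : ∀ m, ∑ k, M.d k * u k * ∑ l, (M.N m k l : ℂ) * M.d l = M.d m * E := fun m => by
    rw [M.sum_mul_sum_N m _ M.d (Or.inl rfl), hE']
  have hk7 : ∀ m, ∑ k, M.d k * ∑ l, (M.N m k l : ℂ) * (M.d l * u l) = M.d m * E := fun m =>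
    M.sum_mul_sum_N m M.d _ (Or.inr rfl)
  have hk2 : ∀ m, ∑ j, M.d j * ∑ k, (M.N j k m : ℂ) * M.d k = M.d m * M.D := fun m => by
    simp only [M.sum_N_mul_d]
    rw [← M.sum_d_mul_d, Finset.mul_sum]
    exact Finset.sum_congr rfl fun j _ => by ring
  have f1 : ∑ j, ∑ k, ∑ l, M.d j * M.d k * M.d l * ∑ m, (M.N i j m * M.N m k l : ℂ) * u m =
      M.d i * M.D * E := by
    rw [e1, hE, Finset.mul_sum]
    simp only [hk, M.sum_N_mul_d]
    exact Finset.sum_congr rfl fun j _ => by ring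
  have f2 : ∑ j, ∑ k, ∑ l, M.d j * M.d k * M.d l * ∑ m, (M.N j k m * M.N i m l : ℂ) * u m =
      M.d i * M.D * E := by
    rw [e2, hE, Finset.mul_sum]
    simp only [hk2, ← M.d_mul]
    exact Finset.sum_congr rfl fun j _ => by ring
  have f4 : ∑ j, ∑ k, ∑ l, M.d j * M.d k * M.d l * ∑ m, (M.N i j m * M.N m k l : ℂ) * u i =
      M.D ^ 2 * M.d i * u i := by
    rw [e4]
    simp only [hk, M.sum_N_mul_d]
    rw [pow_two, mul_assoc, mul_assoc]
    nth_rw 2 [← M.sum_d_mul_d]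
    simp only [Finset.sum_mul]
    exact Finset.sum_congr rfl fun j _ => by ring
  have f5 : ∑ j, ∑ k, ∑ l, M.d j * u j * M.d k * M.d l *
      ∑ m, (M.N i j m * M.N m k l : ℂ) * 1 = M.d i * M.D * E := by
    rw [e5]
    simp only [hk, one_mul]
    calc _ = M.D * ∑ m, M.d m * ∑ j, (M.N i j m : ℂ) * (M.d j * u j) := by
          rw [Finset.mul_sum]
          exact Finset.sum_congr rfl fun j _ => by ring
      _ = M.D * (M.d i * E) := by
          congr 1
          rw [hE, Finset.mul_sum]
          simp only [Finset.mul_sum]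
          rw [Finset.sum_comm]
          refine Finset.sum_congr rfl fun j _ => ?_
          calc _ = (∑ m, M.N i j m * M.d m) * (M.d j * u j) := by
                rw [Finset.sum_mul]
                exact Finset.sum_congr rfl fun k _ => by ring
            _ = _ := by rw [← M.d_mul]; ring
      _ = _ := by ring
  have hg : ∀ x : ℂ, ∑ m, M.d i * M.d m * (M.d m * x) = M.d i * M.D * x := fun x => by
    rw [← M.sum_d_mul_d, Finset.mul_sum, Finset.sum_mul]
    exact Finset.sum_congr rfl fun j _ => by ring
  have f6 : ∑ j, ∑ k, ∑ l, M.d j * (M.d k * u k) * M.d l *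
      ∑ m, (M.N i j m * M.N m k l : ℂ) * 1 = M.d i * M.D * E := by
    rw [e6]
    simp only [hk6, M.sum_N_mul_d, one_mul]
    exact hg E
  have f7 : ∑ j, ∑ k, ∑ l, M.d j * M.d k * (M.d l * u l) *
      ∑ m, (M.N i j m * M.N m k l : ℂ) * 1 = M.d i * M.D * E := by
    rw [e7]
    simp only [hk7, M.sum_N_mul_d, one_mul]
    exact hg E
  calc _ = ∑ j, ∑ k, ∑ l, (M.d j * M.d k * M.d l * ∑ m, (M.N i j m * M.N m k l : ℂ) * u m +
        M.d j * M.d k * M.d l * ∑ m, (M.N j k m * M.N i m l : ℂ) * u m +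
        M.d j * M.d k * M.d l * ∑ m, (M.N i k m * M.N m j l : ℂ) * u m -
        M.d j * M.d k * M.d l * ∑ m, (M.N i j m * M.N m k l : ℂ) * u i -
        M.d j * u j * M.d k * M.d l * ∑ m, (M.N i j m * M.N m k l : ℂ) * 1 -
        M.d j * (M.d k * u k) * M.d l * ∑ m, (M.N i j m * M.N m k l : ℂ) * 1 -
        M.d j * M.d k * (M.d l * u l) * ∑ m, (M.N i j m * M.N m k l : ℂ) * 1) := by
        refine Finset.sum_congr rfl fun j _ => Finset.sum_congr rfl fun k _ =>
          Finset.sum_congr rfl fun l _ => ?_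
        simp only [add_mul, Finset.sum_add_distrib, ← Finset.sum_mul]
        ring
    _ = _ := by
        simp only [Finset.sum_add_distrib, Finset.sum_sub_distrib]
        rw [e3, f1, f2, f4, f5, f6, f7]
        ring

theorem isIntegral_of_vafaRelation {u : I → ℂ} (hu : M.VafaRelation u) (i : I) :
    IsIntegral ℤ (M.D ^ 2 * M.d i * u i) := by
  rw [← neg_neg (M.D ^ 2 * M.d i * u i), ← M.weighted_vafa]
  refine (IsIntegral.sum _ fun j _ => IsIntegral.sum _ fun k _ => IsIntegral.sum _ fun l _ =>
    ?_).neg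
  obtain ⟨z, hz⟩ := hu i j k l
  rw [hz]
  exact (((M.isIntegral_d j).mul (M.isIntegral_d k)).mul (M.isIntegral_d l)).mul
    (isIntegral_algebraMap (x := z))

/-- Source of the exponent 5/2: the factor d_i is traded for r by multiplying with r / d_i. -/
theorem isIntegral_pow_five_mul {u : I → ℂ} (hu : M.VafaRelation u) {r : ℂ} (hr : r ^ 2 = M.D)
    (i : I) : IsIntegral ℤ (r ^ 5 * u i) := by
  have h := (M.isIntegral_of_vafaRelation hu i).mul (M.isIntegral_div_d hr i)
  have hd := M.d_ne_zero i
  have e : r ^ 5 * u i = M.D ^ 2 * M.d i * u i * (r / M.d i) := by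
    rw [← hr]
    field_simp
  rwa [e]

end Vafa

/-! ### Gauss sum and the modular relation -/

section Gauss

/-- The Gauss sum. -/
def p : ℂ := ∑ i, M.θ i * M.d i ^ 2

theorem θ_mul_sum (i : I) : M.θ i * ∑ k, M.d k * M.θ k * M.s k i = M.p * M.d i := by
  calc _ = ∑ k, M.d k * (M.θ k * M.θ i * M.s k i) := by
        rw [Finset.mul_sum]
        exact Finset.sum_congr rfl fun j _ => by ring
    _ = ∑ l, (∑ k, M.N k i l * M.d k) * (M.θ l * M.d l) := by
        simp only [M.θ_mul_s, Finset.mul_sum, Finset.sum_mul]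
        rw [Finset.sum_comm]
        exact Finset.sum_congr rfl fun j _ => Finset.sum_congr rfl fun k _ => by ring
    _ = _ := by
        simp only [M.sum_N_mul_d', p, Finset.sum_mul]
        exact Finset.sum_congr rfl fun j _ => by ring

theorem p_mul_sum (j : I) : M.p * ∑ i, M.s j i * ((M.θ i)⁻¹ * M.d i) = M.D * (M.θ j * M.d j) := by
  have h1 : ∀ i, M.p * ((M.θ i)⁻¹ * M.d i) = ∑ k, M.s i k * (M.d k * M.θ k) := by
    intro i
    have := M.θ_ne_zero i
    rw [mul_left_comm, ← M.θ_mul_sum, inv_mul_cancel_left₀ this]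
    exact Finset.sum_congr rfl fun k _ => by rw [M.s_comm]; ring
  have h2 : M.sDual.mulVec (M.s.mulVec fun k => M.d k * M.θ k) (M.dual j) =
      M.D * (M.d (M.dual j) * M.θ (M.dual j)) := by
    rw [Matrix.mulVec_mulVec, M.sDual_mul, M.mul_sDual, Matrix.mulVec_diagonal]
  rw [M.d_dual, M.θ_dual, mul_comm (M.d j)] at h2
  rw [← h2, Matrix.mulVec, dotProduct, Finset.mul_sum]
  refine Finset.sum_congr rfl fun i _ => ?_
  rw [mul_left_comm, h1, sDual_apply, M.dual_dual]
  rfl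

/-- This is p s T⁻¹ s = D T s T entrywise. Fusing i and j by `s_mul` reduces it to the case of the
unit, `p_mul_sum`. -/
theorem p_mul_sum_s (i j : I) : M.p * ∑ k, M.s i k * (M.θ k)⁻¹ * M.s k j =
    M.D * (M.θ i * M.s i j * M.θ j) := by
  calc _ = M.p * ∑ k, (M.θ k)⁻¹ * (M.s k i * M.s k j) := by
        congr 1
        exact Finset.sum_congr rfl fun k _ => by rw [M.s_comm i k]; ring
    _ = ∑ l, M.N i j l * (M.p * ∑ k, M.s l k * ((M.θ k)⁻¹ * M.d k)) := by
        simp only [M.s_mul, Finset.mul_sum]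
        rw [Finset.sum_comm]
        refine Finset.sum_congr rfl fun l _ => Finset.sum_congr rfl fun k _ => ?_
        rw [M.s_comm l k]; ring
    _ = M.D * ∑ l, M.N i j l * (M.θ l * M.d l) := by
        simp only [M.p_mul_sum, Finset.mul_sum]
        exact Finset.sum_congr rfl fun k _ => by ring
    _ = _ := by rw [← M.θ_mul_s]; ring

theorem p_pow_mul_det : M.p ^ Fintype.card I * M.s.det =
    M.D ^ Fintype.card I * (∏ i, M.θ i) ^ 3 := by
  have h : M.p • (M.s * Matrix.diagonal (fun k => (M.θ k)⁻¹) * M.s) =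
      M.D • (Matrix.diagonal M.θ * M.s * Matrix.diagonal M.θ) := by
    ext i j
    have := M.p_mul_sum_s i j
    simpa [Matrix.mul_apply (M := M.s * _), Matrix.mul_diagonal, Matrix.diagonal_mul] using this
  have hd := congrArg Matrix.det h
  have hθ : ∏ i, M.θ i ≠ 0 := Finset.prod_ne_zero_iff.2 fun i _ => M.θ_ne_zero i
  simp only [Matrix.det_smul, Matrix.det_mul, Matrix.det_diagonal, Finset.prod_inv_distrib] at hd
  have hs := M.det_s_ne_zero
  field_simp at hd
  linear_combination hd

/-- Taking fourth powers removes det s, whose square is known only up to the sign of the duality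
permutation. -/
theorem p_pow_four : M.p ^ (4 * Fintype.card I) = M.D ^ (2 * Fintype.card I) *
    ∏ i, M.θ i ^ 12 := by
  have h := congrArg (· ^ 4) M.p_pow_mul_det
  simp only [mul_pow] at h
  rw [M.det_s_pow_four] at h
  have hD := pow_ne_zero (2 * Fintype.card I) M.D_ne_zero
  apply mul_right_cancel₀ hD
  rw [Finset.prod_pow]
  calc _ = (M.p ^ Fintype.card I) ^ 4 * M.D ^ (2 * Fintype.card I) := by ring
    _ = _ := by rw [h]; ring

end Gauss

end ModularData

/-! ### Logarithms, ℚ-linear maps and the central charge -/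

namespace ModularData

variable {I : Type*} [Fintype I] [DecidableEq I] (M : ModularData I)

theorem exists_log : ∃ t : I → ℂ, ∀ i, Complex.exp (2 * Real.pi * Complex.I * t i) = M.θ i := by
  refine ⟨fun i => Complex.log (M.θ i) / (2 * Real.pi * Complex.I), fun i => ?_⟩
  rw [mul_div_cancel₀ _ Complex.two_pi_I_ne_zero, Complex.exp_log (M.θ_ne_zero i)]

omit [Fintype I] [DecidableEq I] in
theorem exp_sum_mul (s : Finset I) (n : I → ℕ) (t θ : I → ℂ)
    (h : ∀ i, Complex.exp (2 * Real.pi * Complex.I * t i) = θ i) :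
    Complex.exp (2 * Real.pi * Complex.I * ∑ i ∈ s, n i * t i) = ∏ i ∈ s, θ i ^ n i := by
  rw [Finset.mul_sum, Complex.exp_sum]
  refine Finset.prod_congr rfl fun i _ => ?_
  rw [← h, ← Complex.exp_nat_mul]
  congr 1
  ring

theorem exists_int_of_exp_eq {x y : ℂ} (h : Complex.exp (2 * Real.pi * Complex.I * x) =
    Complex.exp (2 * Real.pi * Complex.I * y)) : ∃ z : ℤ, x - y = z := by
  obtain ⟨z, hz⟩ := Complex.exp_eq_exp_iff_exists_int.1 h
  refine ⟨z, mul_left_cancel₀ Complex.two_pi_I_ne_zero ?_⟩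
  linear_combination hz

/-- The logarithms satisfy the relations modulo ℤ; the coefficients are integers and L fixes ℤ, so
their images do too. -/
theorem vafaRelation_of_exp {t : I → ℂ}
    (h : ∀ i, Complex.exp (2 * Real.pi * Complex.I * t i) = M.θ i) {L : ℂ →ₗ[ℚ] ℂ} (hL : L 1 = 1) :
    M.VafaRelation fun i => L (t i) := by
  intro i j k l
  have hv := M.vafa i j k l
  rw [← exp_sum_mul _ _ t M.θ h, ← h, ← h, ← h, ← h, ← Complex.exp_add, ← Complex.exp_add,
    ← Complex.exp_add, ← Complex.exp_nat_mul] at hv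
  rw [show ∀ (K : ℂ) (a b c e : ℂ), K * (2 * Real.pi * Complex.I * a + 2 * Real.pi * Complex.I * b +
    2 * Real.pi * Complex.I * c + 2 * Real.pi * Complex.I * e) =
    2 * Real.pi * Complex.I * (K * (a + b + c + e)) by intros; ring] at hv
  obtain ⟨z, hz⟩ := exists_int_of_exp_eq hv.symm
  refine ⟨z, ?_⟩
  have h1 := congrArg L hz
  have hn : ∀ (n : ℕ) (x : ℂ), L (n * x) = n * L x := fun n x => by
    rw [← nsmul_eq_mul, map_nsmul, nsmul_eq_mul]
  have hz' : L (z : ℂ) = z := by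
    rw [← mul_one (z : ℂ), ← zsmul_eq_mul, map_zsmul, hL]
  rw [map_sub, map_sum, hz', hn] at h1
  simp only [hn, map_add] at h1
  push_cast at h1
  exact h1

/-- Apply L to cN/2 - 12 ∑ t_i ∈ ℤ, the logarithm of `p_pow_four`, and multiply by r^5. The identity
map gives the refinement; other choices of L give rationality. -/
theorem isIntegral_linearMap_centralCharge {c r : ℂ} (hr : r ^ 2 = M.D)
    (hc : Complex.exp (Real.pi * Complex.I * c / 4) = M.p / r) {L : ℂ →ₗ[ℚ] ℂ} (hL : L 1 = 1) :
    IsIntegral ℤ (L c * Fintype.card I * r ^ 5 / 2) := by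
  obtain ⟨t, ht⟩ := M.exists_log
  have hr0 : r ≠ 0 := fun h => M.D_ne_zero (by rw [← hr, h]; norm_num)
  have h1 : Complex.exp (2 * Real.pi * Complex.I * ((Fintype.card I : ℚ) / 2 * c : ℂ)) =
      Complex.exp (2 * Real.pi * Complex.I * ∑ i, (12 : ℕ) * t i) := by
    rw [exp_sum_mul _ (fun _ => 12) t M.θ ht]
    calc _ = Complex.exp (Real.pi * Complex.I * c / 4) ^ (4 * Fintype.card I) := by
          rw [← Complex.exp_nat_mul]
          congr 1
          push_cast
          ring
      _ = _ := by
          rw [hc, div_pow, M.p_pow_four, ← hr, ← pow_mul,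
            show 2 * (2 * Fintype.card I) = 4 * Fintype.card I by ring,
            mul_div_cancel_left₀ _ (pow_ne_zero _ hr0)]
  obtain ⟨z, hz⟩ := exists_int_of_exp_eq h1
  have hz' : L (z : ℂ) = z := by
    rw [← mul_one (z : ℂ), ← zsmul_eq_mul, map_zsmul, hL]
  have hq : ∀ (q : ℚ) (x : ℂ), L (q * x) = q * L x := fun q x => by
    rw [← Rat.smul_def, map_smul, Rat.smul_def]
  have h2 := congrArg L hz
  have hcast : ((Fintype.card I : ℚ) / 2 * c : ℂ) = ((Fintype.card I / 2 : ℚ) : ℂ) * c := by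
    push_cast; ring
  have h12 : ((12 : ℕ) : ℂ) = ((12 : ℚ) : ℂ) := by norm_num
  rw [map_sub, map_sum, hz', hcast, hq] at h2
  simp only [h12, hq] at h2
  have h3 : L c * Fintype.card I * r ^ 5 / 2 = r ^ 5 * z + 12 * ∑ i, r ^ 5 * L (t i) := by
    rw [← Finset.mul_sum, ← h2, ← Finset.mul_sum]
    push_cast
    ring
  rw [h3]
  have hr5 : IsIntegral ℤ (r ^ 5) := by
    refine IsIntegral.pow (IsIntegral.of_pow (n := 2) (by norm_num) ?_) 5
    rw [hr]
    exact M.isIntegral_D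
  have hu := M.vafaRelation_of_exp ht hL
  exact (hr5.mul (isIntegral_algebraMap (x := z))).add
    ((isIntegral_algebraMap (R := ℤ) (A := ℂ) (x := 12)).mul
      (IsIntegral.sum _ fun i _ => M.isIntegral_pow_five_mul hu hr i))

theorem centralCharge_rational {c r : ℂ} (hr : r ^ 2 = M.D)
    (hc : Complex.exp (Real.pi * Complex.I * c / 4) = M.p / r) : ∃ q : ℚ, c = q := by
  by_contra h
  have hr0 : r ≠ 0 := fun h => M.D_ne_zero (by rw [← hr, h]; norm_num)
  have : Nonempty I := ⟨M.one⟩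
  have hI : (Fintype.card I : ℂ) ≠ 0 := Nat.cast_ne_zero.2 Fintype.card_ne_zero
  -- This value makes the number that should be integral equal to 1/2.
  obtain ⟨L, hL, hLc⟩ := exists_linearMap_of_irrational h (1 / (Fintype.card I * r ^ 5))
  have h1 := M.isIntegral_linearMap_centralCharge hr hc hL
  rw [hLc] at h1
  have h2 : 1 / (Fintype.card I * r ^ 5) * Fintype.card I * r ^ 5 / 2 = 1 / 2 := by
    field_simp
  rw [h2] at h1
  exact not_isIntegral_half h1

end ModularData

/-! ### From the category to its modular data -/

section Modular

variable (C : Type u) [Category.{v} C] [Abelian C] [Linear ℂ C]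
  [MonoidalCategory C] [MonoidalPreadditive C] [MonoidalLinear ℂ C]
  [BraidedCategory C] [RigidCategory C] [RibbonCategory C] [ModularTensorCategory C]

omit [MonoidalPreadditive C] [MonoidalLinear ℂ C] [ModularTensorCategory C] in
theorem twistScalar_ne_zero [FiniteSemisimple C] (i : SimpleClass C) : twistScalar i ≠ 0 := by
  intro h
  have h1 := (RibbonCategory.twist i.rep).hom_inv_id
  rw [twist_rep, h, zero_smul, Limits.zero_comp] at h1
  exact id_nonzero i.rep h1.symm

/-- The numerical data of a modular tensor category. -/
def modularData : ModularData (SimpleClass C) where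
  N := fusion
  s := sMatrix C
  d i := qdim i.rep
  θ := twistScalar
  dual := SimpleClass.dual
  one := SimpleClass.mk (𝟙_ C)
  N_comm := fusion_comm
  N_dual := fusion_dual
  dual_dual := SimpleClass.dual_dual
  d_dual := qdim_dual
  θ_dual := twistScalar_dual
  θ_ne_zero := twistScalar_ne_zero C
  d_mul i j := by rw [← qdim_tensor, qdim_eq_sum]; rfl
  θ_mul_s := hopfLink_mul_twist
  s_mul i j k := by
    have h := qdim_mul_hopfLink_tensor i.rep j.rep k.rep
    rw [hopfLink_eq_sum i.rep (j.rep ⊗ k.rep)] at h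
    exact h.symm
  s_one j := by
    have e := (SimpleClass.nonempty_iso_rep_mk (𝟙_ C)).some
    exact (hopfLink_congr_left e j.rep).symm.trans (hopfLink_unit j.rep)
  vafa := twistScalar_vafa
  isUnit_det_s := ModularTensorCategory.isUnit_det_sMatrix

end Modular

end MTC

end

theorem mainTheorem3 (C : Type u) [Category.{v} C] [Abelian C] [Linear ℂ C]
    [MonoidalCategory C] [MonoidalPreadditive C] [MonoidalLinear ℂ C]
    [BraidedCategory C] [RigidCategory C] [MTC.RibbonCategory C] [MTC.ModularTensorCategory C]
    (c : ℂ) (hc : MTC.IsCentralCharge C c) :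
    (∃ q : ℚ, c = q) ∧
      IsIntegral ℤ (c * Nat.card (MTC.SimpleClass C) * MTC.globalDim C ^ (5 / 2 : ℂ) / 2) := by
  -- The argument works for any square root of D, so positivity of D is never needed.
  have hr : (MTC.globalDim C ^ (1 / 2 : ℂ)) ^ 2 = (MTC.modularData C).D := by
    rw [← Complex.cpow_nat_mul]
    norm_num
    rfl
  have hr5 : MTC.globalDim C ^ (5 / 2 : ℂ) = (MTC.globalDim C ^ (1 / 2 : ℂ)) ^ 5 := by
    rw [← Complex.cpow_nat_mul]
    norm_num
  refine ⟨(MTC.modularData C).centralCharge_rational hr hc, ?_⟩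
  rw [hr5, Nat.card_eq_fintype_card]
  exact (MTC.modularData C).isIntegral_linearMap_centralCharge hr hc (L := LinearMap.id) rfl
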